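/- Let $N, d \in \mathbb{N}$. Let $E = (\mathrm{Mat}^h_N(\mathbb{C}))^{2d}$ be the finite-dimensional real Hilbert space of $2d$-vectors $(A,B) = (A_1,\dots,A_d,B_1,\dots,B_d)$ of Hermitian $N\times N$ matrices, with inner product $\langle (A,B),(F,G)\rangle = \sum_{\mu=1}^d \big(\mathrm{Tr}(A_\mu F_\mu) + \mathrm{Tr}(B_\mu G_\mu)\big)$, and let $\mu_{N,d}$ be the standard Gaussian measure on $E$, with characteristic function $\exp(-\frac12|F|^2)$. Let $(E) \subset L^2(\mu_{N,d})$ be the space of Hida test functions: those $\varphi$ with chaos decomposition $\varphi = \sum_n \langle :\!x^{\otimes n}\!:, \varphi^{(n)}\rangle$ such that $\|\varphi\|_q^2 = \sum_n n!\, 2^{nq}\, |\varphi^{(n)}|^2 < \infty$ for all $q \in \mathbb{N}$, with the topology of these norms. Let $(E)'$, the space of Hida distributions, be its topological dual with the strong topology, and write $\langle\!\langle \Phi, \varphi\rangle\!\rangle$ for the bilinear dual pairing, which extends $\int \Phi\,\varphi \, d\mu_{N,d}$. The $T$-transform of $\Phi \in (E)'$ is $T\Phi(F,G) = \langle\!\langle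 \Phi, \exp(i\langle \cdot, (F,G)\rangle)\rangle\!\rangle$ for $(F,G) \in E$. For $\epsilon > 0$ let $$\Phi_{N,d,\epsilon}(A,B) = 2^{dN}\pi^{dN^2} \exp\Big(-\tfrac12 \big((A,B), K_\epsilon (A,B)\big)\Big), \qquad K_\epsilon (A,B) = -\big((1-\epsilon)(A,B) + i\,(B,A)\big),$$ where $(\cdot,\cdot)$ is the complex bilinear extension of the inner product of $E$. Then every $\Phi_{N,d,\epsilon}$ is a Hida distribution, acting on test functions by $\varphi \mapsto \int \Phi_{N,d,\epsilon}\, \varphi \, d\mu_{N,d}$ (the integrals converge absolutely), and there exists a Hida distribution $\Phi_{N,d} \in (E)'$ such that $$\lim_{\epsilon \downarrow 0} \Phi_{N,d,\epsilon} = \Phi_{N,d}$$ in the strong topology of $(E)'$, and its $T$-transform is $$T\Phi_{N,d}(F,G) = 2^{dN}\pi^{dN^2} \exp\Big(-i \sum_{\mu=1}^d \mathrm{Tr}(F_\mu G_\mu)\Big), \qquad (F,G) \in E.$$ -/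

import Mathlib

open MeasureTheory ProbabilityTheory Filter Topology
open scoped ENNReal

noncomputable section

/-! ## Hida test functions and Hida distributions over a Euclidean space

`E` is a finite-dimensional real inner product space, so that the underlying Gel'fand triple is
`E = E = E`, and `stdGaussian E` is the standard Gaussian measure, with characteristic function
`exp (-|F|² / 2)`. -/

namespace Hida

section Hermite

/-- The squares of the weights of the `q`-th norm
`∑_n n! 2^{nq} |f^{(n)}|² = ∑_α α! 2^{q|α|} |c_α|²`. -/
def weight {ι : Type*} [Fintype ι] (q : ℕ) (α : ι → ℕ) : ℝ :=
  ∏ i, (((α i).factorial : ℝ) * 2 ^ (q * α i))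

theorem weight_nonneg {ι : Type*} [Fintype ι] (q : ℕ) (α : ι → ℕ) : 0 ≤ weight q α :=
  Finset.prod_nonneg fun i _ => by positivity

/-- The Wick monomial `:x^α:` in the coordinates of an orthonormal basis, i.e. the product over `i`
of the probabilists' Hermite polynomials of degree `α i` at the `i`-th coordinate of `x`. -/
def wickMonomial {ι E : Type*} [Fintype ι] [NormedAddCommGroup E] [InnerProductSpace ℝ E]
    (b : OrthonormalBasis ι ℝ E) (α : ι → ℕ) (x : E) : ℝ :=
  ∏ i, Polynomial.aeval (inner ℝ (b i) x) (Polynomial.hermite (α i))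

theorem continuous_wickMonomial {ι E : Type*} [Fintype ι] [NormedAddCommGroup E]
    [InnerProductSpace ℝ E] (b : OrthonormalBasis ι ℝ E) (α : ι → ℕ) :
    Continuous (wickMonomial b α) := by
  refine continuous_finsetProd _ fun i _ => ?_
  exact (Polynomial.continuous_aeval (A := ℝ) (Polynomial.hermite (α i))).comp (by fun_prop)

theorem integrable_aeval (p : Polynomial ℤ) :
    Integrable (fun x : ℝ => Polynomial.aeval x p) (gaussianReal 0 1) := by
  simp only [Polynomial.aeval_eq_sum_range]
  refine integrable_finsetSum _ fun i _ => ?_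
  refine Integrable.smul (p.coeff i) ?_
  have h := (memLp_id_gaussianReal (μ := 0) (v := 1) (i : NNReal)).integrable_norm_pow'
  refine h.mono' (by fun_prop) (ae_of_all _ fun x => ?_)
  simp

theorem integrable_aeval_mul_exp (p : Polynomial ℤ) (t : ℝ) :
    Integrable (fun x : ℝ => ((Polynomial.aeval x p : ℝ) : ℂ) * Complex.exp (Complex.I * (x * t)))
      (gaussianReal 0 1) := by
  refine (integrable_aeval p).norm.mono' ?_ (ae_of_all _ fun x => ?_)
  · refine Continuous.aestronglyMeasurable ?_
    have := p.continuous_aeval (A := ℝ)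
    fun_prop
  · rw [norm_mul, mul_comm Complex.I, ← Complex.ofReal_mul, Complex.norm_exp_ofReal_mul_I]
    simp

theorem norm_integral_hermite_mul_exp_le (n : ℕ) (t : ℝ) :
    ‖∫ x, ((Polynomial.aeval x (Polynomial.hermite n) : ℝ) : ℂ) *
      Complex.exp (Complex.I * (x * t)) ∂(gaussianReal 0 1)‖ ≤ |t| ^ n := by
  induction n with
  | zero =>
    refine (norm_integral_le_integral_norm _).trans ?_
    have : ∀ x : ℝ, ‖((Polynomial.aeval x (Polynomial.hermite 0) : ℝ) : ℂ) *
        Complex.exp (Complex.I * (x * t))‖ = 1 := fun x => by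
      rw [norm_mul, mul_comm Complex.I, ← Complex.ofReal_mul, Complex.norm_exp_ofReal_mul_I]
      simp
    rw [integral_congr_ae (ae_of_all _ this)]
    simp
  | succ n ih =>
    set p := Polynomial.hermite n with hp
    set g : Polynomial ℤ → ℝ → ℂ := fun p x =>
      ((Polynomial.aeval x p : ℝ) : ℂ) * Complex.exp (Complex.I * (x * t)) with hg
    have hI : ∀ p, Integrable (fun x => gaussianPDFReal 0 1 x • g p x) := fun p => by
      have := integrable_aeval_mul_exp p t
      rw [gaussianReal_of_var_ne_zero _ one_ne_zero,
        integrable_withDensity_iff_integrable_smul' (measurable_gaussianPDF _ _)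
          (ae_of_all _ fun x => gaussianPDF_lt_top)] at this
      simpa [toReal_gaussianPDF] using this
    have hd : ∀ x : ℝ, HasDerivAt (fun x => gaussianPDFReal 0 1 x • g p x)
        (Complex.I * t * (gaussianPDFReal 0 1 x • g p x)
          - gaussianPDFReal 0 1 x • g (Polynomial.hermite (n + 1)) x) x := fun x => by
      have h1 : HasDerivAt (fun x : ℝ => gaussianPDFReal 0 1 x) (-x * gaussianPDFReal 0 1 x) x := by
        unfold gaussianPDFReal
        have : HasDerivAt (fun x : ℝ => -(x - 0) ^ 2 / (2 * ((1 : NNReal) : ℝ))) (-x) x := by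
          have := (((hasDerivAt_id x).sub_const 0).pow 2).neg.div_const (2 * ((1 : NNReal) : ℝ))
          refine this.congr_deriv ?_
          simp
          ring
        refine (this.exp.const_mul _).congr_deriv ?_
        ring
      have h2 := (p.hasDerivAt_aeval x).ofReal_comp
      have h3 : HasDerivAt (fun x : ℝ => Complex.exp (Complex.I * (x * t)))
          (Complex.exp (Complex.I * (x * t)) * (Complex.I * (1 * t))) x := by
        refine HasDerivAt.cexp ?_
        exact (((hasDerivAt_id x).ofReal_comp).mul_const (t : ℂ)).const_mul Complex.I
      refine (h1.smul (h2.mul h3)).congr_deriv ?_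
      simp only [hg, Polynomial.hermite_succ, ← hp, map_sub, map_mul, Polynomial.aeval_X,
        Complex.real_smul, Complex.ofReal_sub, Complex.ofReal_mul, Complex.ofReal_neg,
        Pi.mul_apply]
      ring
    have h0 := integral_eq_zero_of_hasDerivAt_of_integrable hd
      (((hI p).const_mul _).sub (hI _)) (hI p)
    rw [integral_sub ((hI p).const_mul _) (hI _), integral_const_mul, sub_eq_zero,
      ← integral_gaussianReal_eq_integral_smul one_ne_zero,
      ← integral_gaussianReal_eq_integral_smul one_ne_zero] at h0
    change ‖∫ x, g (Polynomial.hermite (n + 1)) x ∂(gaussianReal 0 1)‖ ≤ _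
    rw [← h0, norm_mul, norm_mul, Complex.norm_I, one_mul, Complex.norm_real, Real.norm_eq_abs,
      pow_succ']
    gcongr

theorem summable_prod {ι : Type*} [Fintype ι] (f : ι → ℕ → ℝ) (hf : ∀ i n, 0 ≤ f i n)
    (hs : ∀ i, Summable (f i)) : Summable fun α : ι → ℕ => ∏ i, f i (α i) := by
  classical
  refine summable_of_sum_le (c := ∏ i, ∑' n, f i n)
    (fun α => Finset.prod_nonneg fun i _ => hf i _) fun u => ?_
  calc ∑ α ∈ u, ∏ i, f i (α i)
      ≤ ∑ α ∈ Fintype.piFinset fun i => u.image fun α => α i, ∏ i, f i (α i) := by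
        refine Finset.sum_le_sum_of_subset_of_nonneg (fun α hα => ?_)
          fun α _ _ => Finset.prod_nonneg fun i _ => hf i _
        exact Fintype.mem_piFinset.2 fun i => Finset.mem_image_of_mem _ hα
    _ = ∏ i, ∑ n ∈ u.image fun α => α i, f i n := (Finset.prod_univ_sum _ _).symm
    _ ≤ _ := Finset.prod_le_prod (fun i _ => Finset.sum_nonneg fun n _ => hf i n)
        fun i _ => (hs i).sum_le_tsum _ fun n _ => hf i n

end Hermite

section Euclidean

variable {ι E : Type*} [Fintype ι] [NormedAddCommGroup E] [InnerProductSpace ℝ E]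
  [FiniteDimensional ℝ E] [MeasurableSpace E] [BorelSpace E]

theorem memLp_wickMonomial (b : OrthonormalBasis ι ℝ E) (α : ι → ℕ) :
    MemLp (fun x => (wickMonomial b α x : ℂ)) 2 (stdGaussian E) := by
  have hc := continuous_wickMonomial b α
  have hm : Measurable fun x : ι → ℝ => ∑ i, x i • b i := by fun_prop
  rw [memLp_two_iff_integrable_sq_norm (by fun_prop),
    stdGaussian_eq_map_pi_orthonormalBasis b, integrable_map_measure (by fun_prop) hm.aemeasurable]
  have : ((fun x => ‖(wickMonomial b α x : ℂ)‖ ^ 2) ∘ fun x : ι → ℝ => ∑ i, x i • b i) =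
      fun x => ∏ i, Polynomial.aeval (x i) (Polynomial.hermite (α i) ^ 2) := by
    classical
    ext x
    simp [wickMonomial, inner_sum, inner_smul_right, b.inner_eq_ite, Finset.prod_pow, ← sq_abs]
  rw [this]
  exact Integrable.fintype_prod fun i => integrable_aeval _

theorem integrable_mul_wickMonomial (b : OrthonormalBasis ι ℝ E) (α : ι → ℕ)
    (f : Lp ℂ 2 (stdGaussian E)) :
    Integrable (fun x => f x * (wickMonomial b α x : ℂ)) (stdGaussian E) :=
  (Lp.memLp f).integrable_mul (memLp_wickMonomial b α)

/-- The coefficients `c_α` of the Wiener–Itô–Segal chaos decomposition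
`f = ∑_α c_α :x^α:` of a square-integrable function `f`. The `n`-th kernel `f^{(n)}` of `f` is the
symmetric tensor with the coefficients `c_α`, `|α| = n`, and
`n! |f^{(n)}|² = ∑_{|α| = n} α! |c_α|²`. -/
def chaosCoeff (b : OrthonormalBasis ι ℝ E) (α : ι → ℕ) : Lp ℂ 2 (stdGaussian E) →ₗ[ℂ] ℂ where
  toFun f := (∏ i, ((α i).factorial : ℂ))⁻¹ * ∫ x, f x * (wickMonomial b α x : ℂ) ∂(stdGaussian E)
  map_add' f g := by
    rw [← mul_add, ← integral_add (integrable_mul_wickMonomial b α f)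
      (integrable_mul_wickMonomial b α g)]
    congr 1
    refine integral_congr_ae ?_
    filter_upwards [Lp.coeFn_add f g] with x hx
    rw [hx, Pi.add_apply, add_mul]
  map_smul' c f := by
    rw [RingHom.id_apply, smul_eq_mul, mul_left_comm, ← integral_const_mul c]
    congr 1
    refine integral_congr_ae ?_
    filter_upwards [Lp.coeFn_smul c f] with x hx
    rw [hx, Pi.smul_apply, smul_eq_mul, mul_assoc]

/-- The chaos coefficients, weighted for the `q`-th norm. -/
def weightedCoeff (b : OrthonormalBasis ι ℝ E) (q : ℕ) :
    Lp ℂ 2 (stdGaussian E) →ₗ[ℂ] ((ι → ℕ) → ℂ) :=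
  LinearMap.pi fun α => ((Real.sqrt (weight q α) : ℝ) : ℂ) • chaosCoeff b α

/-- The space of Hida test functions, as a subspace of `L²`: all weighted norms
`∑_α α! 2^{q|α|} |c_α|² = ∑_n n! 2^{nq} |f^{(n)}|²` are finite. -/
def testSubmodule (b : OrthonormalBasis ι ℝ E) : Submodule ℂ (Lp ℂ 2 (stdGaussian E)) where
  carrier := {f | ∀ q : ℕ, Memℓp (weightedCoeff b q f) 2}
  add_mem' hf hg q := by
    rw [map_add]
    exact (hf q).add (hg q)
  zero_mem' q := by
    rw [map_zero]
    exact zero_memℓp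
  smul_mem' c f hf q := by
    rw [map_smul]
    exact (hf q).const_smul c

/-- The space of Hida test functions. This is a type of its own, because it carries another topology
than a subspace of `L²` does. -/
def Test (b : OrthonormalBasis ι ℝ E) : Type _ := testSubmodule b

instance (b : OrthonormalBasis ι ℝ E) : AddCommGroup (Test b) :=
  inferInstanceAs (AddCommGroup (testSubmodule b))

instance (b : OrthonormalBasis ι ℝ E) : Module ℂ (Test b) :=
  inferInstanceAs (Module ℂ (testSubmodule b))

/-- The inclusion of the Hida test functions into `L²`. -/
def Test.toL2 (b : OrthonormalBasis ι ℝ E) : Test b →ₗ[ℂ] Lp ℂ 2 (stdGaussian E) :=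
  (testSubmodule b).subtype

/-- The map from the Hida test functions to the `q`-th weighted Hilbert space of coefficients. -/
def Test.toHilbert (b : OrthonormalBasis ι ℝ E) (q : ℕ) :
    Test b →ₗ[ℂ] lp (fun _ : ι → ℕ => ℂ) 2 where
  toFun φ := ⟨weightedCoeff b q (Test.toL2 b φ), φ.2 q⟩
  map_add' φ ψ := Subtype.ext (map_add ((weightedCoeff b q).comp (Test.toL2 b)) φ ψ)
  map_smul' c φ := Subtype.ext (map_smul ((weightedCoeff b q).comp (Test.toL2 b)) c φ)

/-- The topology of the Hida test functions: the projective limit topology of the weighted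
norms. -/
instance (b : OrthonormalBasis ι ℝ E) : TopologicalSpace (Test b) :=
  ⨅ q : ℕ, TopologicalSpace.induced (Test.toHilbert b q) inferInstance

instance (b : OrthonormalBasis ι ℝ E) : IsTopologicalAddGroup (Test b) :=
  topologicalAddGroup_iInf fun q => topologicalAddGroup_induced (Test.toHilbert b q)

instance (b : OrthonormalBasis ι ℝ E) : ContinuousSMul ℂ (Test b) :=
  continuousSMul_iInf fun q => continuousSMul_induced (Test.toHilbert b q)

/-- The space of Hida distributions, the topological dual of the Hida test functions. Its topology
is the strong one, of uniform convergence on the bounded sets of test functions. -/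
abbrev Distribution (b : OrthonormalBasis ι ℝ E) : Type _ := StrongDual ℂ (Test b)

/-- The Hida distribution `Φ` is the one given by the function `f`, in the bilinear dual pairing
`⟪Φ, φ⟫ = ∫ f φ dμ` that extends the one of `L²`. -/
def IsGivenBy {b : OrthonormalBasis ι ℝ E} (Φ : Distribution b) (f : E → ℂ) : Prop :=
  ∀ φ : Test b, Integrable (fun x => f x * Test.toL2 b φ x) (stdGaussian E) ∧
    Φ φ = ∫ x, f x * Test.toL2 b φ x ∂(stdGaussian E)

theorem memLp_expI (F : E) :
    MemLp (fun x : E => Complex.exp (Complex.I * (inner ℝ x F : ℝ))) 2 (stdGaussian E) := by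
  refine MemLp.of_bound (by fun_prop) 1 (ae_of_all _ fun x => ?_)
  rw [mul_comm, Complex.norm_exp_ofReal_mul_I]

theorem norm_chaosCoeff_expI_le (b : OrthonormalBasis ι ℝ E) (F : E) (α : ι → ℕ) :
    ‖chaosCoeff b α ((memLp_expI F).toLp _)‖ ≤ ∏ i, (((α i).factorial : ℝ)⁻¹ * |inner ℝ (b i) F| ^ α i) := by
  classical
  have h1 : ∫ x, ((memLp_expI F).toLp _) x * (wickMonomial b α x : ℂ) ∂(stdGaussian E) =
      ∏ i, ∫ x, ((Polynomial.aeval x (Polynomial.hermite (α i)) : ℝ) : ℂ) *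
        Complex.exp (Complex.I * (x * (inner ℝ (b i) F : ℝ))) ∂(gaussianReal 0 1) := by
    have hm : Measurable fun x : ι → ℝ => ∑ i, x i • b i := by fun_prop
    have hc := continuous_wickMonomial b α
    calc _ = ∫ x, Complex.exp (Complex.I * (inner ℝ x F : ℝ)) * (wickMonomial b α x : ℂ)
          ∂(stdGaussian E) := by
          refine integral_congr_ae ?_
          filter_upwards [(memLp_expI F).coeFn_toLp] with x hx
          rw [hx]
      _ = _ := by
          rw [stdGaussian_eq_map_pi_orthonormalBasis b, integral_map hm.aemeasurable (by fun_prop),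
            ← integral_fintype_prod_eq_prod (𝕜 := ℂ) fun i (x : ℝ) =>
              ((Polynomial.aeval x (Polynomial.hermite (α i)) : ℝ) : ℂ) *
                Complex.exp (Complex.I * (x * (inner ℝ (b i) F : ℝ)))]
          refine integral_congr_ae (ae_of_all _ fun x => ?_)
          simp only [Finset.prod_mul_distrib, wickMonomial, sum_inner, inner_sum, inner_smul_right,
            real_inner_smul_left, b.inner_eq_ite, Complex.ofReal_prod, Complex.ofReal_sum,
            Finset.mul_sum, Complex.exp_sum, Complex.ofReal_mul]
          rw [mul_comm]
          simp
  change ‖(∏ i, ((α i).factorial : ℂ))⁻¹ * _‖ ≤ _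
  rw [h1, norm_mul, norm_inv, Finset.prod_mul_distrib, Finset.prod_inv_distrib, norm_prod, norm_prod]
  simp only [Complex.norm_natCast]
  gcongr with i
  exact norm_integral_hermite_mul_exp_le _ _

/-- The exponential `exp (i ⟨·, F⟩)` as a Hida test function. -/
def expTest (b : OrthonormalBasis ι ℝ E) (F : E) : Test b :=
  ⟨(memLp_expI F).toLp _, fun q => by
    rw [memℓp_gen_iff (by norm_num)]
    refine Summable.of_nonneg_of_le (fun α => by positivity) (fun α => ?_)
      (summable_prod (fun i n => (2 ^ q * |inner ℝ (b i) F| ^ 2) ^ n / n.factorial)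
        (fun i n => by positivity) fun i => Real.summable_pow_div_factorial _)
    have h := norm_chaosCoeff_expI_le b F α
    simp only [weightedCoeff, LinearMap.pi_apply, LinearMap.smul_apply, norm_smul,
      Complex.norm_real, ENNReal.toReal_ofNat, Real.rpow_ofNat, Real.norm_eq_abs, mul_pow, sq_abs,
      Real.sq_sqrt (weight_nonneg q α)]
    calc _ ≤ weight q α * (∏ i, (((α i).factorial : ℝ)⁻¹ * |inner ℝ (b i) F| ^ α i)) ^ 2 := by
          have := weight_nonneg q α
          gcongr
      _ = _ := by
          rw [weight, ← Finset.prod_pow, ← Finset.prod_mul_distrib]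
          refine Finset.prod_congr rfl fun i _ => ?_
          have : ((α i).factorial : ℝ) ≠ 0 := by positivity
          rw [← sq_abs (inner ℝ (b i) F)]
          field_simp
          ring⟩

/-- The `T`-transform `TΦ(F) = ⟪Φ, exp (i ⟨·, F⟩)⟫` of a Hida distribution. -/
def tTransform {b : OrthonormalBasis ι ℝ E} (Φ : Distribution b) (F : E) : ℂ :=
  Φ (expTest b F)

end Euclidean

end Hida

/-! ## Hermitian matrices -/

/-- The real vector space of Hermitian `N × N` matrices. -/
def HermMat (N : ℕ) : Type := selfAdjoint (Matrix (Fin N) (Fin N) ℂ)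

namespace HermMat

variable {N : ℕ}

instance : AddCommGroup (HermMat N) :=
  inferInstanceAs (AddCommGroup (selfAdjoint (Matrix (Fin N) (Fin N) ℂ)))

instance : Module ℝ (HermMat N) :=
  inferInstanceAs (Module ℝ (selfAdjoint (Matrix (Fin N) (Fin N) ℂ)))

/-- The underlying matrix. -/
def toMatrix : HermMat N →ₗ[ℝ] Matrix (Fin N) (Fin N) ℂ where
  toFun A := A.1
  map_add' _ _ := rfl
  map_smul' _ _ := rfl

theorem toMatrix_injective : Function.Injective (toMatrix (N := N)) := Subtype.val_injective

theorem conjTranspose_toMatrix (A : HermMat N) : A.toMatrix.conjTranspose = A.toMatrix := A.2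

instance : FiniteDimensional ℝ (HermMat N) :=
  FiniteDimensional.of_injective toMatrix toMatrix_injective

open scoped ComplexOrder in
theorem trace_mul_self_re_nonneg (A : HermMat N) : 0 ≤ (A.toMatrix * A.toMatrix).trace.re := by
  have h := (Matrix.posSemidef_conjTranspose_mul_self A.toMatrix).trace_nonneg
  rw [conjTranspose_toMatrix] at h
  exact (Complex.le_def.1 h).1

open scoped ComplexOrder in
theorem eq_zero_of_trace_mul_self_re (A : HermMat N)
    (h : (A.toMatrix * A.toMatrix).trace.re = 0) : A = 0 := by
  have h0 := (Matrix.posSemidef_conjTranspose_mul_self A.toMatrix).trace_nonneg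
  rw [conjTranspose_toMatrix] at h0
  have h1 : (A.toMatrix.conjTranspose * A.toMatrix).trace = 0 := by
    rw [conjTranspose_toMatrix]
    exact Complex.ext h (Complex.le_def.1 h0).2.symm
  exact toMatrix_injective ((Matrix.trace_conjTranspose_mul_self_eq_zero_iff.1 h1).trans
    (map_zero _).symm)

/-- The inner product `(A, B) = Tr (B A)`; the trace is real, because `A` and `B` are Hermitian. -/
abbrev innerCore : InnerProductSpace.Core ℝ (HermMat N) where
  inner A B := (B.toMatrix * A.toMatrix).trace.re
  conj_inner_symm A B := by
    rw [Matrix.trace_mul_comm]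
    rfl
  re_inner_nonneg A := trace_mul_self_re_nonneg A
  add_left A B C := by
    simp [mul_add]
  smul_left A B r := by
    simp
  definite A h := eq_zero_of_trace_mul_self_re A h

instance : NormedAddCommGroup (HermMat N) :=
  innerCore.toNormedAddCommGroup

instance : InnerProductSpace ℝ (HermMat N) := InnerProductSpace.ofCore innerCore.toCore

instance : MeasurableSpace (HermMat N) := borel _

instance : BorelSpace (HermMat N) := ⟨rfl⟩

end HermMat

/-- The space of `2d`-vectors of Hermitian `N × N` matrices, with the inner product
`∑_μ Tr (A_μ F_μ) + ∑_μ Tr (B_μ G_μ)` of the pairs `(A, B)` and `(F, G)`. -/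
abbrev HermMatPair (N d : ℕ) : Type := PiLp 2 fun _ : Fin d ⊕ Fin d => HermMat N

/-- The vector `(F, G)` with the components `F_1, …, F_d, G_1, …, G_d`. -/
def HermMatPair.mk {N d : ℕ} (F G : Fin d → HermMat N) : HermMatPair N d :=
  WithLp.toLp 2 (Sum.elim F G)

/-! ## The regularized symplectic Feynman distribution -/

/-- The complexification of the space of `2d`-vectors of Hermitian matrices: `2d`-vectors of
arbitrary complex matrices. -/
abbrev MatPair (N d : ℕ) : Type := Fin d ⊕ Fin d → Matrix (Fin N) (Fin N) ℂ

/-- The inclusion into the complexification. -/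
def HermMatPair.toMatPair {N d : ℕ} (X : HermMatPair N d) : MatPair N d :=
  fun k => (X k).toMatrix

/-- The complex bilinear extension of the inner product of `HermMatPair N d`. -/
def trPairing {N d : ℕ} (X Y : MatPair N d) : ℂ := ∑ k, (X k * Y k).trace

/-- The operator `(A, B) ↦ (B, A)`. -/
def swapOp (N d : ℕ) : MatPair N d →ₗ[ℂ] MatPair N d :=
  LinearMap.funLeft ℂ (Matrix (Fin N) (Fin N) ℂ) Sum.swap

/-- The operator `K_ε = -((1 - ε) Id + i (A, B) ↦ (B, A))`. -/
def regOp (N d : ℕ) (ε : ℝ) : MatPair N d →ₗ[ℂ] MatPair N d :=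
  -((1 - (ε : ℂ)) • LinearMap.id + Complex.I • swapOp N d)

/-- The function `2^{dN} π^{dN²} exp (-½ (X, K_ε X))` of `X = (A, B)`. -/
def regFeynman (N d : ℕ) (ε : ℝ) (X : HermMatPair N d) : ℂ :=
  2 ^ (d * N) * (Real.pi : ℂ) ^ (d * N ^ 2) *
    Complex.exp (-(1 / 2) * trPairing X.toMatPair (regOp N d ε X.toMatPair))

end

/-! Let `S` be the swap `(A, B) ↦ (B, A)`, a symmetric involution of trace zero. Up to the constant,
the regularized function is `quadExp S ε = exp (½ ((1 - ε)|x|² + i⟨x, S x⟩))`. It is dominated by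
`exp (s|x|²)` with `s = (1 - ε)/2 < 1/2`, hence integrable, but for small `ε` not square-integrable.
To pair it with test functions, these are represented by their pointwise chaos series, which grows
more slowly than every `exp (δ|x|²)` (`abs_aeval_hermite_le`, `Test.exists_bound`). The series is
the given `L²` function because the Wick monomials are complete (`Test.toFun_ae_eq`). A distribution
is thus encoded by its values `a α` on the Wick monomials.

For `quadExp S ε`, Gaussian integration by parts and the Hermite recursion give a linear system for
the numbers `a (α + e_i)` in terms of the `α_j a (α - e_j)`. Its matrix is `ε - iT`, with `T` the
matrix of `S`. As `T² = 1`, the inverse is `(ε + iT)/(1 + ε²)`, which stays bounded as `ε → 0`. The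
resulting two-step recursion (`quadCoeff_add_single`) gives a bound `√α! m^|α|` uniform in `ε`
(`hasCoeffBound_of_recursion`) and convergence of each coefficient (`exists_tendsto_of_recursion`).
For `m² < 2^q`, dominated convergence then gives norm convergence in the dual of the `q`-th Hilbert
space, and so strong convergence (`Distribution.tendsto_ofCoeff`).

The limit is identified on exponentials. In an eigenbasis of `S` the integral is a product of
one-dimensional Gaussian integrals (`integral_quadExp_mul_exp`). Each eigenvalue `c = ±1`
contributes a phase `exp (iπc/4)` in the limit; these cancel because the trace is zero, and `exp
(-(i/2)⟨F, S F⟩)` remains. -/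

namespace Hida

/-! ### Growth of the Hermite polynomials. -/

section HermitePolynomials

theorem derivative_hermite_succ (n : ℕ) :
    (Polynomial.hermite (n + 1)).derivative = (n + 1 : ℕ) * Polynomial.hermite n := by
  induction n with
  | zero => simp
  | succ n ih =>
    rw [Polynomial.hermite_succ (n + 1), Polynomial.derivative_sub, Polynomial.derivative_mul, ih,
      Polynomial.derivative_natCast_mul, Polynomial.derivative_X, Polynomial.hermite_succ n]
    push_cast
    ring

theorem derivative_hermite (n : ℕ) :
    (Polynomial.hermite n).derivative = (n : ℕ) * Polynomial.hermite (n - 1) := by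
  cases n with
  | zero => simp
  | succ n => exact derivative_hermite_succ n

theorem aeval_hermite_succ (n : ℕ) (x : ℝ) :
    Polynomial.aeval x (Polynomial.hermite (n + 1)) =
      x * Polynomial.aeval x (Polynomial.hermite n) -
        n * Polynomial.aeval x (Polynomial.hermite (n - 1)) := by
  rw [Polynomial.hermite_succ, derivative_hermite]
  simp

/-- After division by `√n!` the three-term recursion multiplies the bound by at most `1 + |x|/√(n+1)
≤ exp (|x|/√(n+1))`, and the sum of the `1/√k`, `k ≤ n`, is at most `2√n`. -/
theorem abs_aeval_hermite_le_sqrt (n : ℕ) (x : ℝ) :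
    |(Polynomial.aeval x (Polynomial.hermite n) : ℝ)| ≤
      √(n.factorial : ℝ) * Real.exp (2 * |x| * √(n : ℝ)) := by
  induction n using Nat.strong_induction_on with
  | _ n ih =>
  cases n with
  | zero => simp
  | succ n =>
    have hn1 : (0 : ℝ) < √((n : ℝ) + 1) := by positivity
    have hsq1 : √((n : ℝ) + 1) ^ 2 = n + 1 := Real.sq_sqrt (by positivity)
    have hsq0 : √(n : ℝ) ^ 2 = n := Real.sq_sqrt (by positivity)
    have hmono : √(n : ℝ) ≤ √((n : ℝ) + 1) := Real.sqrt_le_sqrt (by linarith)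
    have hfac : √((n + 1).factorial : ℝ) = √((n : ℝ) + 1) * √(n.factorial : ℝ) := by
      rw [Nat.factorial_succ, Nat.cast_mul, Real.sqrt_mul (by positivity)]
      push_cast
      rfl
    have h0 := ih n (by omega)
    have h1 : n * |(Polynomial.aeval x (Polynomial.hermite (n - 1)) : ℝ)| ≤
        √((n + 1).factorial : ℝ) * Real.exp (2 * |x| * √(n : ℝ)) := by
      cases n with
      | zero => simp
      | succ m =>
        have h := ih m (by omega)
        have hm : √(m : ℝ) ≤ √((m + 1 : ℕ) : ℝ) := Real.sqrt_le_sqrt (by push_cast; linarith)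
        have hf : √((m + 1).factorial : ℝ) = √((m + 1 : ℕ) : ℝ) * √(m.factorial : ℝ) := by
          rw [Nat.factorial_succ, Nat.cast_mul, Real.sqrt_mul (by positivity)]
        calc ((m + 1 : ℕ) : ℝ) * |(Polynomial.aeval x (Polynomial.hermite m) : ℝ)|
            ≤ ((m + 1 : ℕ) : ℝ) * (√(m.factorial : ℝ) *
              Real.exp (2 * |x| * √((m + 1 : ℕ) : ℝ))) := by
              gcongr
              exact h.trans (by gcongr)
          _ = √((m + 1 : ℕ) : ℝ) ^ 2 * √(m.factorial : ℝ) *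
              Real.exp (2 * |x| * √((m + 1 : ℕ) : ℝ)) := by rw [hsq0]; ring
          _ = √((m + 1 : ℕ) : ℝ) * √((m + 1).factorial : ℝ) *
              Real.exp (2 * |x| * √((m + 1 : ℕ) : ℝ)) := by rw [hf]; ring
          _ ≤ _ := by
              rw [hfac]
              gcongr
    have hexp : |x| * (1 / √((n : ℝ) + 1)) + 2 * |x| * √(n : ℝ) ≤ 2 * |x| * √((n : ℝ) + 1) := by
      -- The right side equals `2/(√(n+1) + √n)`.
      have : 1 / √((n : ℝ) + 1) ≤ 2 * (√((n : ℝ) + 1) - √(n : ℝ)) := by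
        rw [div_le_iff₀ hn1]
        nlinarith [sq_nonneg (√((n : ℝ) + 1) - √(n : ℝ))]
      nlinarith [abs_nonneg x]
    rw [aeval_hermite_succ]
    calc |x * Polynomial.aeval x (Polynomial.hermite n) -
          n * Polynomial.aeval x (Polynomial.hermite (n - 1))|
        ≤ |x| * |(Polynomial.aeval x (Polynomial.hermite n) : ℝ)| +
          n * |(Polynomial.aeval x (Polynomial.hermite (n - 1)) : ℝ)| := by
          refine (abs_sub _ _).trans (le_of_eq ?_)
          rw [abs_mul, abs_mul, Nat.abs_cast]
      _ ≤ |x| * (√(n.factorial : ℝ) * Real.exp (2 * |x| * √(n : ℝ))) +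
          √((n + 1).factorial : ℝ) * Real.exp (2 * |x| * √(n : ℝ)) := by gcongr
      _ = √((n + 1).factorial : ℝ) * ((|x| * (1 / √((n : ℝ) + 1)) + 1) *
          Real.exp (2 * |x| * √(n : ℝ))) := by
          rw [hfac]
          field_simp
      _ ≤ √((n + 1).factorial : ℝ) * (Real.exp (|x| * (1 / √((n : ℝ) + 1))) *
          Real.exp (2 * |x| * √(n : ℝ))) := by
          gcongr
          exact Real.add_one_le_exp _
      _ ≤ √((n + 1).factorial : ℝ) * Real.exp (2 * |x| * √((n + 1 : ℕ) : ℝ)) := by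
          rw [← Real.exp_add]
          push_cast
          gcongr

/-- From `2|x|√n ≤ n/δ + δx²`. The dependence on `n` is now geometric, which the weights `2^{nq}`
absorb for large `q`, while `δ` may be as small as desired. -/
theorem abs_aeval_hermite_le {δ : ℝ} (hδ : 0 < δ) (n : ℕ) (x : ℝ) :
    |(Polynomial.aeval x (Polynomial.hermite n) : ℝ)| ≤
      √(n.factorial : ℝ) * (Real.exp (1 / δ) ^ n * Real.exp (δ * x ^ 2)) := by
  refine (abs_aeval_hermite_le_sqrt n x).trans ?_
  rw [← Real.exp_nat_mul, ← Real.exp_add]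
  gcongr
  have h : √(n : ℝ) ^ 2 = n := Real.sq_sqrt (by positivity)
  have key : 0 ≤ (δ * |x| - √(n : ℝ)) ^ 2 / δ := by positivity
  have : (δ * |x| - √(n : ℝ)) ^ 2 / δ =
      (n * (1 / δ) + δ * x ^ 2) - 2 * |x| * √(n : ℝ) := by
    rw [← sq_abs x, ← h]
    field_simp
    rw [Real.sqrt_sq (by positivity)]
    ring
  linarith

end HermitePolynomials

/-! ### Recursion, derivatives and growth of the Wick monomials. -/

section WickMonomials

variable {ι E : Type*} [Fintype ι] [DecidableEq ι] [NormedAddCommGroup E] [InnerProductSpace ℝ E]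

theorem prod_pi_add_single {M : Type*} [CommMonoid M] (f : ι → ℕ → M) (α : ι → ℕ) (i : ι) (k : ℕ) :
    ∏ j, f j ((α + Pi.single i k : ι → ℕ) j) =
      f i (α i + k) * ∏ j ∈ Finset.univ.erase i, f j (α j) := by
  rw [← Finset.mul_prod_erase _ _ (Finset.mem_univ i)]
  congr 1
  · simp
  · refine Finset.prod_congr rfl fun j hj => ?_
    simp [Finset.ne_of_mem_erase hj]

theorem prod_pi_sub_single {M : Type*} [CommMonoid M] (f : ι → ℕ → M) (α : ι → ℕ) (i : ι) (k : ℕ) :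
    ∏ j, f j ((α - Pi.single i k : ι → ℕ) j) =
      f i (α i - k) * ∏ j ∈ Finset.univ.erase i, f j (α j) := by
  rw [← Finset.mul_prod_erase _ _ (Finset.mem_univ i)]
  congr 1
  · simp
  · refine Finset.prod_congr rfl fun j hj => ?_
    simp [Finset.ne_of_mem_erase hj]

omit [DecidableEq ι] in
@[simp]
theorem wickMonomial_zero (b : OrthonormalBasis ι ℝ E) (x : E) : wickMonomial b 0 x = 1 := by
  simp [wickMonomial]

/-- If `α i = 0`, truncated subtraction makes `α - Pi.single i 1` equal to `α`. This is harmless,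
here and in the later recursions, because the factor `α i` vanishes. -/
theorem wickMonomial_add_single (b : OrthonormalBasis ι ℝ E) (α : ι → ℕ) (i : ι) (x : E) :
    wickMonomial b (α + Pi.single i 1) x =
      inner ℝ (b i) x * wickMonomial b α x - α i * wickMonomial b (α - Pi.single i 1) x := by
  simp only [wickMonomial]
  rw [prod_pi_add_single (fun j n => Polynomial.aeval (inner ℝ (b j) x) (Polynomial.hermite n)),
    prod_pi_sub_single (fun j n => Polynomial.aeval (inner ℝ (b j) x) (Polynomial.hermite n)),
    ← Finset.mul_prod_erase _ _ (Finset.mem_univ i), aeval_hermite_succ]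
  ring

theorem inner_mul_wickMonomial (b : OrthonormalBasis ι ℝ E) (α : ι → ℕ) (i : ι) (x : E) :
    inner ℝ (b i) x * wickMonomial b α x =
      wickMonomial b (α + Pi.single i 1) x + α i * wickMonomial b (α - Pi.single i 1) x := by
  rw [wickMonomial_add_single]
  ring

theorem hasLineDerivAt_wickMonomial (b : OrthonormalBasis ι ℝ E) (α : ι → ℕ) (i : ι) (x : E) :
    HasLineDerivAt ℝ (wickMonomial b α) (α i * wickMonomial b (α - Pi.single i 1) x) x (b i) := by
  have h (t : ℝ) : wickMonomial b α (x + t • b i) =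
      Polynomial.aeval (inner ℝ (b i) x + t) (Polynomial.hermite (α i)) *
        ∏ j ∈ Finset.univ.erase i,
          Polynomial.aeval (inner ℝ (b j) x) (Polynomial.hermite (α j)) := by
    rw [wickMonomial, ← Finset.mul_prod_erase _ _ (Finset.mem_univ i)]
    congr 1
    · simp [inner_add_right, inner_smul_right]
    · refine Finset.prod_congr rfl fun j hj => ?_
      simp [inner_add_right, inner_smul_right, b.inner_eq_ite, Finset.ne_of_mem_erase hj]
  rw [HasLineDerivAt]
  simp only [h]
  have h1 := ((Polynomial.hermite (α i)).hasDerivAt_aeval (inner ℝ (b i) x + 0)).comp_const_add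
    (inner ℝ (b i) x) 0
  refine (h1.mul_const _).congr_deriv ?_
  rw [wickMonomial,
    prod_pi_sub_single (fun j n => Polynomial.aeval (inner ℝ (b j) x) (Polynomial.hermite n)),
    derivative_hermite, add_zero]
  simp [mul_assoc]

omit [DecidableEq ι] in
theorem abs_wickMonomial_le (b : OrthonormalBasis ι ℝ E) {δ : ℝ} (hδ : 0 < δ) (α : ι → ℕ) (x : E) :
    |wickMonomial b α x| ≤
      (∏ i, √((α i).factorial : ℝ)) * Real.exp (1 / δ) ^ (∑ i, α i) * Real.exp (δ * ‖x‖ ^ 2) := by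
  rw [wickMonomial, Finset.abs_prod, ← b.sum_sq_inner_right x, Finset.mul_sum, Real.exp_sum,
    ← Finset.prod_pow_eq_pow_sum, mul_assoc, ← Finset.prod_mul_distrib, ← Finset.prod_mul_distrib]
  exact Finset.prod_le_prod (fun i _ => abs_nonneg _) fun i _ => abs_aeval_hermite_le hδ _ _

end WickMonomials

/-! ### Calculus of Gaussian growth bounds. -/

section GaussianBound

variable {E : Type*} [NormedAddCommGroup E]

/-- A function that is dominated by `exp (s |x|²)` for some `s < 1 / 2`, and therefore bounded by an
integrable function for the standard Gaussian measure. -/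
def HasGaussianBound (f : E → ℂ) : Prop :=
  ∃ K s : ℝ, s < 1 / 2 ∧ ∀ x, ‖f x‖ ≤ K * Real.exp (s * ‖x‖ ^ 2)

theorem HasGaussianBound.mono {f g : E → ℂ} (hf : HasGaussianBound f) (h : ∀ x, ‖g x‖ ≤ ‖f x‖) :
    HasGaussianBound g := by
  obtain ⟨K, s, hs, hK⟩ := hf
  exact ⟨K, s, hs, fun x => (h x).trans (hK x)⟩

theorem HasGaussianBound.add {f g : E → ℂ} (hf : HasGaussianBound f) (hg : HasGaussianBound g) :
    HasGaussianBound (fun x => f x + g x) := by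
  obtain ⟨K, s, hs, hK⟩ := hf
  obtain ⟨L, t, ht, hL⟩ := hg
  refine ⟨|K| + |L|, max s t, max_lt hs ht, fun x => ?_⟩
  calc ‖f x + g x‖ ≤ ‖f x‖ + ‖g x‖ := norm_add_le _ _
    _ ≤ |K| * Real.exp (max s t * ‖x‖ ^ 2) + |L| * Real.exp (max s t * ‖x‖ ^ 2) := by
        refine add_le_add ((hK x).trans ?_) ((hL x).trans ?_)
        · exact mul_le_mul (le_abs_self K)
            (Real.exp_le_exp.2 (mul_le_mul_of_nonneg_right (le_max_left s t) (by positivity)))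
            (by positivity) (by positivity)
        · exact mul_le_mul (le_abs_self L)
            (Real.exp_le_exp.2 (mul_le_mul_of_nonneg_right (le_max_right s t) (by positivity)))
            (by positivity) (by positivity)
    _ = _ := by ring

/-- A function that grows slower than every `exp (δ |x|²)`. -/
def IsGaussianSmall (p : E → ℂ) : Prop :=
  ∀ δ : ℝ, 0 < δ → ∃ K : ℝ, ∀ x, ‖p x‖ ≤ K * Real.exp (δ * ‖x‖ ^ 2)

theorem HasGaussianBound.mul {f p : E → ℂ} (hf : HasGaussianBound f) (hp : IsGaussianSmall p) :
    HasGaussianBound (fun x => f x * p x) := by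
  obtain ⟨K, s, hs, hK⟩ := hf
  -- Half of the gap between `s` and `1/2`, so that the product still has an exponent below `1/2`.
  obtain ⟨L, hL⟩ := hp ((1 / 2 - s) / 2) (by linarith)
  refine ⟨K * L, s + (1 / 2 - s) / 2, by linarith, fun x => ?_⟩
  rw [norm_mul, add_mul, Real.exp_add]
  calc ‖f x‖ * ‖p x‖ ≤ (K * Real.exp (s * ‖x‖ ^ 2)) * (L * Real.exp ((1 / 2 - s) / 2 * ‖x‖ ^ 2)) :=
        mul_le_mul (hK x) (hL x) (norm_nonneg _) ((norm_nonneg _).trans (hK x))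
    _ = _ := by ring

theorem IsGaussianSmall.mul {p q : E → ℂ} (hp : IsGaussianSmall p) (hq : IsGaussianSmall q) :
    IsGaussianSmall (fun x => p x * q x) := by
  intro δ hδ
  obtain ⟨K, hK⟩ := hp (δ / 2) (by linarith)
  obtain ⟨L, hL⟩ := hq (δ / 2) (by linarith)
  refine ⟨K * L, fun x => ?_⟩
  rw [norm_mul, show δ * ‖x‖ ^ 2 = δ / 2 * ‖x‖ ^ 2 + δ / 2 * ‖x‖ ^ 2 by ring, Real.exp_add]
  calc ‖p x‖ * ‖q x‖ ≤ (K * Real.exp (δ / 2 * ‖x‖ ^ 2)) * (L * Real.exp (δ / 2 * ‖x‖ ^ 2)) :=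
        mul_le_mul (hK x) (hL x) (norm_nonneg _) ((norm_nonneg _).trans (hK x))
    _ = _ := by ring

theorem IsGaussianSmall.hasGaussianBound {p : E → ℂ} (hp : IsGaussianSmall p) :
    HasGaussianBound p := by
  obtain ⟨K, hK⟩ := hp (1 / 4) (by norm_num)
  exact ⟨K, 1 / 4, by norm_num, hK⟩

theorem isGaussianSmall_const (c : ℂ) : IsGaussianSmall (fun _ : E => c) := by
  intro δ hδ
  refine ⟨‖c‖, fun x => ?_⟩
  exact le_mul_of_one_le_right (norm_nonneg _) (Real.one_le_exp (by positivity))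

theorem isGaussianSmall_exp_norm (c : ℝ) :
    IsGaussianSmall (fun x : E => ((Real.exp (c * ‖x‖) : ℝ) : ℂ)) := by
  intro δ hδ
  refine ⟨Real.exp (c ^ 2 / (4 * δ)), fun x => ?_⟩
  rw [Complex.norm_real, Real.norm_eq_abs, Real.abs_exp, ← Real.exp_add]
  gcongr
  have key : 0 ≤ (c - 2 * δ * ‖x‖) ^ 2 / (4 * δ) := by positivity
  have : (c - 2 * δ * ‖x‖) ^ 2 / (4 * δ) = c ^ 2 / (4 * δ) + δ * ‖x‖ ^ 2 - c * ‖x‖ := by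
    field_simp
    ring
  linarith

theorem IsGaussianSmall.mono {p q : E → ℂ} (hp : IsGaussianSmall p) (h : ∀ x, ‖q x‖ ≤ ‖p x‖) :
    IsGaussianSmall q := fun δ hδ =>
  let ⟨K, hK⟩ := hp δ hδ
  ⟨K, fun x => (h x).trans (hK x)⟩

variable [InnerProductSpace ℝ E]

theorem isGaussianSmall_wickMonomial {ι : Type*} [Fintype ι] (b : OrthonormalBasis ι ℝ E) (α : ι → ℕ) :
    IsGaussianSmall (fun x => (wickMonomial b α x : ℂ)) := by
  intro δ hδ
  refine ⟨(∏ i, √((α i).factorial : ℝ)) * Real.exp (1 / δ) ^ (∑ i, α i), fun x => ?_⟩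
  rw [Complex.norm_real]
  exact abs_wickMonomial_le b hδ α x

theorem isGaussianSmall_inner (v : E) : IsGaussianSmall (fun x : E => ((inner ℝ v x : ℝ) : ℂ)) := by
  refine (isGaussianSmall_exp_norm ‖v‖).mono fun x => ?_
  rw [Complex.norm_real, Complex.norm_real, Real.norm_eq_abs (Real.exp _), Real.abs_exp]
  refine (norm_inner_le_norm v x).trans ?_
  linarith [Real.add_one_le_exp (‖v‖ * ‖x‖)]

end GaussianBound

/-! ### Density of the Gaussian measure and integration by parts. -/

section GaussianMeasure

variable {ι E : Type*} [Fintype ι] [NormedAddCommGroup E] [InnerProductSpace ℝ E]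
  [FiniteDimensional ℝ E] [MeasurableSpace E] [BorelSpace E]

/-- The density of the standard Gaussian measure. -/
noncomputable def stdGaussianPDF (x : E) : ℝ :=
  ((2 * Real.pi) ^ (Module.finrank ℝ E / 2 : ℝ))⁻¹ * Real.exp (-(1 / 2) * ‖x‖ ^ 2)

omit [FiniteDimensional ℝ E] [MeasurableSpace E] [BorelSpace E] in
theorem stdGaussianPDF_nonneg (x : E) : 0 ≤ stdGaussianPDF x := by
  unfold stdGaussianPDF
  positivity

theorem integrable_exp_neg_mul_norm_sq {c : ℝ} (hc : 0 < c) :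
    Integrable (fun x : E => Real.exp (-c * ‖x‖ ^ 2)) := by
  have h := (GaussianFourier.integrable_cexp_neg_mul_sq_norm_add (V := E)
    (show 0 < (c : ℂ).re from hc) 0 0).norm
  refine h.congr (ae_of_all _ fun x => ?_)
  simp only [zero_mul, add_zero, Complex.norm_exp]
  norm_cast

/-- Both sides are finite measures with the same characteristic function. The density makes
integration by parts for Lebesgue measure available. -/
theorem stdGaussian_eq_withDensity :
    stdGaussian E = volume.withDensity fun x : E => ENNReal.ofReal (stdGaussianPDF x) := by
  have hint : Integrable (stdGaussianPDF : E → ℝ) :=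
    (integrable_exp_neg_mul_norm_sq (by norm_num)).const_mul _
  have := isFiniteMeasure_withDensity_ofReal hint.2
  refine Measure.ext_of_charFun (funext fun t => ?_)
  rw [charFun_stdGaussian, charFun_apply, integral_withDensity_eq_integral_toReal_smul
    (by unfold stdGaussianPDF; fun_prop) (ae_of_all _ fun _ => ENNReal.ofReal_lt_top)]
  have h := GaussianFourier.integral_cexp_neg_mul_sq_norm_add (V := E)
    (show 0 < ((1 / 2 : ℂ)).re by norm_num) Complex.I t
  have h2 : ∀ x : E, (ENNReal.ofReal (stdGaussianPDF x)).toReal •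
      Complex.exp (inner ℝ x t * Complex.I) =
      ((2 * Real.pi : ℂ) ^ (Module.finrank ℝ E / 2 : ℂ))⁻¹ *
        Complex.exp (-(1 / 2) * ‖x‖ ^ 2 + Complex.I * (inner ℝ t x : ℝ)) := fun x => by
    rw [ENNReal.toReal_ofReal (stdGaussianPDF_nonneg x), stdGaussianPDF, Complex.exp_add,
      Complex.real_smul, real_inner_comm x t, mul_comm Complex.I, ← mul_assoc]
    congr 2
    push_cast [Complex.ofReal_cpow (show (0 : ℝ) ≤ 2 * Real.pi by positivity)]
    rfl
  simp only [h2]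
  rw [integral_const_mul, h, ← mul_assoc]
  have h3 : (Real.pi / (1 / 2 : ℂ)) = 2 * Real.pi := by ring
  rw [h3, inv_mul_cancel₀, one_mul]
  · congr 1
    rw [Complex.I_sq]
    ring
  · rw [Complex.cpow_def_of_ne_zero (by simp [Real.pi_ne_zero])]
    exact Complex.exp_ne_zero _

theorem integral_stdGaussian (f : E → ℂ) :
    ∫ x, f x ∂(stdGaussian E) = ∫ x, (stdGaussianPDF x : ℂ) * f x := by
  rw [stdGaussian_eq_withDensity, integral_withDensity_eq_integral_toReal_smul
    (by unfold stdGaussianPDF; fun_prop) (ae_of_all _ fun _ => ENNReal.ofReal_lt_top)]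
  simp only [ENNReal.toReal_ofReal (stdGaussianPDF_nonneg _), Complex.real_smul]

theorem integrable_stdGaussian_iff (f : E → ℂ) :
    Integrable f (stdGaussian E) ↔ Integrable (fun x => (stdGaussianPDF x : ℂ) * f x) := by
  rw [stdGaussian_eq_withDensity, integrable_withDensity_iff_integrable_smul'
    (by unfold stdGaussianPDF; fun_prop) (ae_of_all _ fun _ => ENNReal.ofReal_lt_top)]
  simp only [ENNReal.toReal_ofReal (stdGaussianPDF_nonneg _), Complex.real_smul]

theorem integrable_exp_mul_norm_sq {s : ℝ} (hs : s < 1 / 2) :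
    Integrable (fun x : E => Real.exp (s * ‖x‖ ^ 2)) (stdGaussian E) := by
  refine (integrable_norm_iff (f := fun x : E => ((Real.exp (s * ‖x‖ ^ 2) : ℝ) : ℂ))
    (by fun_prop)).2 ((integrable_stdGaussian_iff _).2 ?_) |>.congr (ae_of_all _ fun x => ?_)
  · have := ((integrable_exp_neg_mul_norm_sq (E := E) (c := 1 / 2 - s) (by linarith)).const_mul
      ((2 * Real.pi) ^ (Module.finrank ℝ E / 2 : ℝ))⁻¹).ofReal (𝕜 := ℂ)
    refine this.congr (ae_of_all _ fun x => ?_)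
    simp only [stdGaussianPDF]
    norm_cast
    rw [mul_assoc, ← Real.exp_add]
    congr 3
    ring
  · simp only [Complex.norm_real, Real.norm_eq_abs, Real.abs_exp]

theorem HasGaussianBound.integrable {f : E → ℂ} (hf : HasGaussianBound f)
    (hm : AEStronglyMeasurable f (stdGaussian E)) : Integrable f (stdGaussian E) := by
  obtain ⟨K, s, hs, hK⟩ := hf
  exact ((integrable_exp_mul_norm_sq hs).const_mul K).mono' hm (ae_of_all _ hK)

/-- Gaussian integration by parts. -/
theorem integral_inner_mul_eq_integral_lineDeriv {g g' : E → ℂ} {v : E}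
    (hd : ∀ x, HasLineDerivAt ℝ g (g' x) x v) (hc : Continuous g) (hc' : Continuous g')
    (hg : HasGaussianBound g) (hg' : HasGaussianBound g') :
    ∫ x, (inner ℝ v x : ℝ) * g x ∂(stdGaussian E) = ∫ x, g' x ∂(stdGaussian E) := by
  have hint := (integrable_stdGaussian_iff g).1 (hg.integrable hc.aestronglyMeasurable)
  have hint' := (integrable_stdGaussian_iff g').1 (hg'.integrable hc'.aestronglyMeasurable)
  have hb : HasGaussianBound fun x => (inner ℝ v x : ℝ) * g x :=
    (hg.mul (isGaussianSmall_inner v)).mono fun x => by rw [mul_comm]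
  have hintv := (integrable_stdGaussian_iff _).1 (hb.integrable (by fun_prop))
  have hpdf (x : E) : HasLineDerivAt ℝ (fun x : E => (stdGaussianPDF x : ℂ))
      (-((inner ℝ v x : ℝ) : ℂ) * stdGaussianPDF x) x v := by
    have h1 : HasLineDerivAt ℝ (fun x : E => ‖x‖ ^ 2) (2 * inner ℝ v x) x v := by
      have := (hasStrictFDerivAt_norm_sq x).hasFDerivAt.hasLineDerivAt v
      simpa [real_inner_comm] using this
    have h2 := ((HasDerivAt.const_mul (-(1 / 2) : ℝ) h1).exp.const_mul
      ((2 * Real.pi) ^ (Module.finrank ℝ E / 2 : ℝ))⁻¹).ofReal_comp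
    refine h2.congr_deriv ?_
    simp only [stdGaussianPDF, zero_smul, add_zero]
    push_cast
    ring
  have key := integral_bilinear_hasLineDerivAt_right_eq_neg_left_of_integrable
    (μ := (volume : Measure E)) (B := ContinuousLinearMap.mul ℝ ℂ) (v := v)
    (f := fun x : E => (stdGaussianPDF x : ℂ)) (g := g)
    (f' := fun x => -((inner ℝ v x : ℝ) : ℂ) * stdGaussianPDF x) (g' := g')
    (by
      refine hintv.neg.congr (ae_of_all _ fun x => ?_)
      simp only [Pi.neg_apply, ContinuousLinearMap.mul_apply']
      ring) hint' hint (fun x _ => hpdf x) (fun x _ => hd x)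
  simp only [ContinuousLinearMap.mul_apply'] at key
  rw [integral_stdGaussian, integral_stdGaussian, key, ← integral_neg]
  refine integral_congr_ae (ae_of_all _ fun x => ?_)
  ring

/-- Raising the degree is adjoint to differentiation. Integration by parts for `g :x^α:` produces
the extra term `α_i g :x^{α-e_i}:`, which is what the Hermite recursion subtracts from `x_i :x^α:`.
-/
theorem integral_mul_wickMonomial_add_single [DecidableEq ι] (b : OrthonormalBasis ι ℝ E)
    {g g' : E → ℂ} {i : ι}
    (hd : ∀ x, HasLineDerivAt ℝ g (g' x) x (b i)) (hc : Continuous g) (hc' : Continuous g')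
    (hg : HasGaussianBound g) (hg' : HasGaussianBound g') (α : ι → ℕ) :
    ∫ x, g x * wickMonomial b (α + Pi.single i 1) x ∂(stdGaussian E) =
      ∫ x, g' x * wickMonomial b α x ∂(stdGaussian E) := by
  have hw := continuous_wickMonomial b
  have hs := isGaussianSmall_wickMonomial b
  have hd2 (x : E) : HasLineDerivAt ℝ (fun x => g x * wickMonomial b α x)
      (g' x * wickMonomial b α x + g x * (α i * wickMonomial b (α - Pi.single i 1) x)) x (b i) := by
    have h1 := HasDerivAt.mul (hd x) (hasLineDerivAt_wickMonomial b α i x).ofReal_comp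
    refine h1.congr_deriv ?_
    simp
  have i1 : Integrable (fun x => g' x * wickMonomial b α x) (stdGaussian E) :=
    (hg'.mul (hs α)).integrable (by have := hw α; fun_prop)
  have b2 : HasGaussianBound fun x => g x * (α i * wickMonomial b (α - Pi.single i 1) x) :=
    hg.mul ((isGaussianSmall_const _).mul (hs _))
  have i2 : Integrable (fun x => g x * (α i * wickMonomial b (α - Pi.single i 1) x))
      (stdGaussian E) := b2.integrable (by have := hw (α - Pi.single i 1); fun_prop)
  have b3 : HasGaussianBound fun x => ((inner ℝ (b i) x : ℝ) : ℂ) * (g x * wickMonomial b α x) :=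
    ((hg.mul (hs α)).mul (isGaussianSmall_inner (b i))).mono fun x => by rw [mul_comm]
  have i3 := b3.integrable (by have := hw α; fun_prop)
  have h := integral_inner_mul_eq_integral_lineDeriv hd2 (by have := hw α; fun_prop)
    (by have := hw α; have := hw (α - Pi.single i 1); fun_prop) (hg.mul (hs α))
    ((hg'.mul (hs α)).add b2)
  rw [integral_add i1 i2] at h
  rw [← sub_eq_iff_eq_add] at h
  rw [← h, ← integral_sub i3 i2]
  refine integral_congr_ae (ae_of_all _ fun x => ?_)
  simp only [wickMonomial_add_single]
  push_cast
  ring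

end GaussianMeasure

/-! ### Orthogonality and completeness of the Wick monomials. -/

section Completeness

variable {ι E : Type*} [Fintype ι] [NormedAddCommGroup E] [InnerProductSpace ℝ E]
  [FiniteDimensional ℝ E] [MeasurableSpace E] [BorelSpace E]

omit [Fintype ι] in
theorem eq_zero_or_eq_add_single [Finite ι] [DecidableEq ι] (α : ι → ℕ) :
    α = 0 ∨ ∃ (β : ι → ℕ) (i : ι), α = β + Pi.single i 1 := by
  by_cases h : α = 0
  · exact Or.inl h
  · obtain ⟨i, hi⟩ := Function.ne_iff.1 h
    refine Or.inr ⟨α - Pi.single i 1, i, ?_⟩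
    ext j
    by_cases hj : j = i
    · subst hj
      have : α j ≠ 0 := hi
      simp
      omega
    · simp [hj]

theorem integral_wickMonomial (b : OrthonormalBasis ι ℝ E) (α : ι → ℕ) :
    ∫ x, (wickMonomial b α x : ℂ) ∂(stdGaussian E) = if α = 0 then 1 else 0 := by
  classical
  rcases eq_zero_or_eq_add_single α with rfl | ⟨β, i, rfl⟩
  · simp
  · have h := integral_mul_wickMonomial_add_single b (g := fun _ => 1) (g' := fun _ => 0) (i := i)
      (fun x => by simpa [HasLineDerivAt] using hasDerivAt_const (0 : ℝ) (1 : ℂ))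
      continuous_const continuous_const (isGaussianSmall_const 1).hasGaussianBound
      (isGaussianSmall_const 0).hasGaussianBound β
    simp only [one_mul, zero_mul, integral_zero] at h
    rw [h, if_neg]
    intro h0
    simpa using congrFun h0 i

/-- By adjointness one unit of `β` is traded for a derivative of `:x^α:`, which lowers `α` by the
same unit and yields a factor `α_i`; these factors build up the factorials. -/
theorem integral_wickMonomial_mul_wickMonomial (b : OrthonormalBasis ι ℝ E) (α β : ι → ℕ) :
    ∫ x, (wickMonomial b α x : ℂ) * wickMonomial b β x ∂(stdGaussian E) =
      if α = β then ∏ i, ((α i).factorial : ℂ) else 0 := by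
  classical
  induction hn : ∑ i, β i using Nat.strong_induction_on generalizing α β with
  | _ n ih =>
  rcases eq_zero_or_eq_add_single β with rfl | ⟨γ, i, rfl⟩
  · simp only [wickMonomial_zero, Complex.ofReal_one, mul_one, integral_wickMonomial]
    split_ifs with h
    · simp [h]
    · rfl
  · have hw := continuous_wickMonomial b
    have h := integral_mul_wickMonomial_add_single b (g := fun x => (wickMonomial b α x : ℂ))
      (g' := fun x => ((α i * wickMonomial b (α - Pi.single i 1) x : ℝ) : ℂ)) (i := i)
      (fun x => (hasLineDerivAt_wickMonomial b α i x).ofReal_comp)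
      (by have := hw α; fun_prop) (by have := hw (α - Pi.single i 1); fun_prop)
      (isGaussianSmall_wickMonomial b α).hasGaussianBound
      (((isGaussianSmall_const (α i : ℂ)).mul
        (isGaussianSmall_wickMonomial b (α - Pi.single i 1))).mono
          fun x => by simp).hasGaussianBound γ
    rw [h]
    simp only [Complex.ofReal_mul, Complex.ofReal_natCast, mul_assoc]
    rw [integral_const_mul, ih (∑ i, γ i) (by simp [← hn, Finset.sum_add_distrib]) _ γ rfl]
    rcases Nat.eq_zero_or_pos (α i) with h0 | h0
    · rw [h0, Nat.cast_zero, zero_mul, if_neg]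
      rintro rfl
      simp at h0
    · have hα : α - Pi.single i 1 + Pi.single i 1 = α := by
        ext j
        by_cases hj : j = i
        · subst hj
          simp
          omega
        · simp [hj]
      by_cases h1 : α - Pi.single i 1 = γ
      · rw [if_pos h1, if_pos (by rw [← h1, hα]), ← Finset.mul_prod_erase _ _ (Finset.mem_univ i),
          ← Finset.mul_prod_erase _ (fun i => ((α i).factorial : ℂ)) (Finset.mem_univ i),
          ← mul_assoc]
        congr 1
        · simp only [Pi.sub_apply, Pi.single_eq_same]
          exact_mod_cast Nat.mul_factorial_pred h0.ne'
        · refine Finset.prod_congr rfl fun j hj => ?_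
          simp [Finset.ne_of_mem_erase hj]
      · rw [if_neg h1, if_neg, mul_zero]
        rintro rfl
        exact h1 (by simp)

theorem IsGaussianSmall.memLp_two {p : E → ℂ} (hp : IsGaussianSmall p)
    (hm : AEStronglyMeasurable p (stdGaussian E)) : MemLp p 2 (stdGaussian E) := by
  rw [memLp_two_iff_integrable_sq_norm hm]
  refine ((hp.mul hp).hasGaussianBound.integrable (hm.mul hm)).norm.congr
    (ae_of_all _ fun x => ?_)
  simp [sq]

/-- The positive and negative parts of `r` are densities of finite measures with equal
characteristic functions, so they agree almost everywhere; as one of them is zero at each point, so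
is `r`. -/
theorem ae_eq_zero_of_forall_integral_mul_exp_eq_zero {F : Type*} [NormedAddCommGroup F]
    [InnerProductSpace ℝ F] [CompleteSpace F] [SecondCountableTopology F] [MeasurableSpace F]
    [BorelSpace F] {μ : Measure F} [SigmaFinite μ] {r : F → ℝ} (hr : Integrable r μ)
    (h : ∀ t : F, ∫ x, (r x : ℂ) * Complex.exp ((inner ℝ x t : ℝ) * Complex.I) ∂μ = 0) :
    r =ᵐ[μ] 0 := by
  have hm : AEMeasurable (fun x => ENNReal.ofReal (r x)) μ :=
    ENNReal.measurable_ofReal.comp_aemeasurable hr.1.aemeasurable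
  have hm' : AEMeasurable (fun x => ENNReal.ofReal (-r x)) μ :=
    ENNReal.measurable_ofReal.comp_aemeasurable hr.1.aemeasurable.neg
  have := isFiniteMeasure_withDensity_ofReal hr.2
  have := isFiniteMeasure_withDensity_ofReal hr.neg.2
  have hexp (t : F) (x : F) : ‖Complex.exp ((inner ℝ x t : ℝ) * Complex.I)‖ ≤ 1 :=
    (Complex.norm_exp_ofReal_mul_I _).le
  have hint (s : F → ℝ) (hs : Integrable s μ) (t : F) :
      Integrable (fun x => ((max (s x) 0 : ℝ) : ℂ) *
        Complex.exp ((inner ℝ x t : ℝ) * Complex.I)) μ :=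
    (hs.pos_part.ofReal (𝕜 := ℂ)).mul_bdd (c := 1) (by fun_prop) (ae_of_all _ (hexp t))
  have heq : μ.withDensity (fun x => ENNReal.ofReal (r x)) =
      μ.withDensity fun x => ENNReal.ofReal (-r x) := by
    refine Measure.ext_of_charFun (funext fun t => ?_)
    rw [charFun_apply, charFun_apply,
      integral_withDensity_eq_integral_toReal_smul₀ hm (ae_of_all _ fun _ => ENNReal.ofReal_lt_top),
      integral_withDensity_eq_integral_toReal_smul₀ hm'
        (ae_of_all _ fun _ => ENNReal.ofReal_lt_top), ← sub_eq_zero]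
    simp only [ENNReal.toReal_ofReal', Complex.real_smul]
    rw [← integral_sub (hint r hr t) (hint (fun x => -r x) hr.neg t), ← h t]
    refine integral_congr_ae (ae_of_all _ fun x => ?_)
    beta_reduce
    rw [← sub_mul, ← Complex.ofReal_sub, max_zero_sub_max_neg_zero_eq_self]
  rw [withDensity_eq_iff_of_sigmaFinite hm hm'] at heq
  filter_upwards [heq] with x hx
  rcases le_total 0 (r x) with h0 | h0
  · rw [ENNReal.ofReal_of_nonpos (by linarith : -r x ≤ 0), ENNReal.ofReal_eq_zero] at hx
    exact le_antisymm hx h0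
  · rw [ENNReal.ofReal_of_nonpos h0, eq_comm, ENNReal.ofReal_eq_zero] at hx
    exact le_antisymm h0 (neg_nonpos.1 hx)

/-- A square-integrable function that is orthogonal to all Wick monomials is orthogonal to all
products of them with powers of a linear form. -/
theorem integral_mul_inner_pow_mul_wickMonomial_eq_zero (b : OrthonormalBasis ι ℝ E)
    (f : Lp ℂ 2 (stdGaussian E))
    (h : ∀ α, ∫ x, f x * (wickMonomial b α x : ℂ) ∂(stdGaussian E) = 0) (F : E) (n : ℕ)
    (α : ι → ℕ) :
    Integrable (fun x => f x * ((inner ℝ x F : ℝ) ^ n * wickMonomial b α x)) (stdGaussian E) ∧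
      ∫ x, f x * ((inner ℝ x F : ℝ) ^ n * wickMonomial b α x) ∂(stdGaussian E) = 0 := by
  classical
  -- All `α` at once, since each multiplication by the linear form moves `α` up or down by one unit.
  induction n generalizing α with
  | zero => simpa using ⟨integrable_mul_wickMonomial b α f, h α⟩
  | succ n ih =>
    have hx (x : E) : f x * ((inner ℝ x F : ℝ) ^ (n + 1) * wickMonomial b α x) =
        ∑ i, (((inner ℝ (b i) F : ℝ) : ℂ) * (f x * ((inner ℝ x F : ℝ) ^ n *
            wickMonomial b (α + Pi.single i 1) x)) +
          ((inner ℝ (b i) F : ℝ) : ℂ) * α i * (f x * ((inner ℝ x F : ℝ) ^ n *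
            wickMonomial b (α - Pi.single i 1) x))) := by
      have h1 : ((inner ℝ x F : ℝ) : ℂ) * wickMonomial b α x =
          ∑ i, ((inner ℝ (b i) F : ℝ) : ℂ) * (wickMonomial b (α + Pi.single i 1) x +
            α i * wickMonomial b (α - Pi.single i 1) x) := by
        rw [← b.sum_inner_mul_inner x F]
        push_cast
        rw [Finset.sum_mul]
        refine Finset.sum_congr rfl fun i _ => ?_
        rw [mul_comm ((inner ℝ x (b i) : ℝ) : ℂ), mul_assoc, real_inner_comm (b i) x]
        congr 1
        exact_mod_cast inner_mul_wickMonomial b α i x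
      rw [pow_succ, mul_assoc, h1, Finset.mul_sum, Finset.mul_sum]
      refine Finset.sum_congr rfl fun i _ => ?_
      ring
    simp only [hx]
    have hi (i : ι) := ((ih (α + Pi.single i 1)).1.const_mul ((inner ℝ (b i) F : ℝ) : ℂ))
    have hj (i : ι) := ((ih (α - Pi.single i 1)).1.const_mul (((inner ℝ (b i) F : ℝ) : ℂ) * α i))
    refine ⟨integrable_finsetSum _ fun i _ => (hi i).fun_add (hj i), ?_⟩
    rw [integral_finsetSum _ fun i _ => (hi i).fun_add (hj i)]
    refine Finset.sum_eq_zero fun i _ => ?_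
    rw [integral_add (hi i) (hj i), integral_const_mul, integral_const_mul, (ih _).2, (ih _).2]
    simp

/-- Expand the exponential: each power of the linear form integrates to zero against `f`. The
dominating function `|f| exp |⟨x, F⟩|` is a product of two `L²` functions. -/
theorem integral_mul_exp_eq_zero_of_forall_wickMonomial (b : OrthonormalBasis ι ℝ E)
    (f : Lp ℂ 2 (stdGaussian E))
    (h : ∀ α, ∫ x, f x * (wickMonomial b α x : ℂ) ∂(stdGaussian E) = 0) (F : E) :
    ∫ x, f x * Complex.exp ((inner ℝ x F : ℝ) * Complex.I) ∂(stdGaussian E) = 0 := by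
  have hf : Integrable f (stdGaussian E) := (Lp.memLp f).integrable (by norm_num)
  have hexp : MemLp (fun x : E => ((Real.exp |inner ℝ x F| : ℝ) : ℂ)) 2 (stdGaussian E) := by
    refine IsGaussianSmall.memLp_two ((isGaussianSmall_exp_norm ‖F‖).mono fun x => ?_)
      (by fun_prop)
    rw [Complex.norm_real, Complex.norm_real, Real.norm_eq_abs, Real.norm_eq_abs, Real.abs_exp,
      Real.abs_exp, Real.exp_le_exp, mul_comm]
    exact abs_real_inner_le_norm x F
  have hsum (x : E) : HasSum (fun n : ℕ => ‖f x‖ * (|inner ℝ x F| ^ n / n.factorial))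
      (‖f x‖ * Real.exp |inner ℝ x F|) := by
    have h1 : HasSum (fun n : ℕ => |inner ℝ x F| ^ n / n.factorial) (Real.exp |inner ℝ x F|) := by
      rw [Real.exp_eq_exp_ℝ]
      exact NormedSpace.expSeries_div_hasSum_exp |inner ℝ x F|
    exact h1.mul_left ‖f x‖
  have hexpC (z : ℂ) : HasSum (fun n : ℕ => z ^ n / n.factorial) (Complex.exp z) := by
    rw [Complex.exp_eq_exp_ℂ]
    exact NormedSpace.expSeries_div_hasSum_exp z
  have key := hasSum_integral_of_dominated_convergence
    (μ := stdGaussian E)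
    (F := fun (n : ℕ) x => f x * (((inner ℝ x F : ℝ) * Complex.I) ^ n / n.factorial))
    (f := fun x => f x * Complex.exp ((inner ℝ x F : ℝ) * Complex.I))
    (fun n x => ‖f x‖ * (|inner ℝ x F| ^ n / n.factorial))
    (fun n => hf.1.mul (by fun_prop))
    (fun n => ae_of_all _ fun x => by simp) (ae_of_all _ fun x => (hsum x).summable)
    (by
      simp only [(hsum _).tsum_eq]
      refine ((Lp.memLp f).integrable_mul hexp).norm.congr (ae_of_all _ fun x => ?_)
      simp only [Pi.mul_apply, norm_mul, Complex.norm_real, Real.norm_eq_abs, Real.abs_exp])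
    (ae_of_all _ fun x => (hexpC ((inner ℝ x F : ℝ) * Complex.I)).mul_left (f x))
  refine key.unique ?_
  have h0 (n : ℕ) : ∫ x, f x * (((inner ℝ x F : ℝ) * Complex.I) ^ n / n.factorial)
      ∂(stdGaussian E) = 0 := by
    have h1 := (integral_mul_inner_pow_mul_wickMonomial_eq_zero b f h F n 0).2
    simp only [wickMonomial_zero, Complex.ofReal_one, mul_one] at h1
    have h2 : ∀ x, f x * (((inner ℝ x F : ℝ) * Complex.I) ^ n / n.factorial) =
        (Complex.I ^ n / n.factorial) * (f x * ((inner ℝ x F : ℝ) : ℂ) ^ n) := fun x => by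
      rw [mul_pow]
      ring
    simp only [h2]
    rw [integral_const_mul, h1, mul_zero]
  simp only [h0]
  exact hasSum_zero

/-- The Wick monomials are complete in `L²`. -/
theorem eq_zero_of_forall_integral_mul_wickMonomial (b : OrthonormalBasis ι ℝ E)
    (f : Lp ℂ 2 (stdGaussian E))
    (h : ∀ α, ∫ x, f x * (wickMonomial b α x : ℂ) ∂(stdGaussian E) = 0) : f = 0 := by
  have hf : Integrable f (stdGaussian E) := (Lp.memLp f).integrable (by norm_num)
  have hF := integral_mul_exp_eq_zero_of_forall_wickMonomial b f h
  have hI (F : E) : Integrable (fun x => f x * Complex.exp ((inner ℝ x F : ℝ) * Complex.I))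
      (stdGaussian E) :=
    hf.mul_bdd (c := 1) (by fun_prop) (ae_of_all _ fun x => (Complex.norm_exp_ofReal_mul_I _).le)
  have hI' (F : E) : Integrable (fun x => (starRingEnd ℂ) (f x) *
      Complex.exp ((inner ℝ x F : ℝ) * Complex.I)) (stdGaussian E) :=
    Integrable.mul_bdd (c := 1) (by
      refine hf.norm.mono' (Complex.continuous_conj.comp_aestronglyMeasurable hf.1) ?_
      exact ae_of_all _ fun x => by simp) (by fun_prop)
      (ae_of_all _ fun x => (Complex.norm_exp_ofReal_mul_I _).le)
  -- Uniqueness is available for real functions only. Conjugation and `F ↦ -F` give the vanishing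
  -- for the conjugate of `f`, hence for its real and imaginary parts.
  have hF' (F : E) : ∫ x, (starRingEnd ℂ) (f x) *
      Complex.exp ((inner ℝ x F : ℝ) * Complex.I) ∂(stdGaussian E) = 0 := by
    have h1 := congrArg (starRingEnd ℂ) (hF (-F))
    rw [← integral_conj, map_zero] at h1
    rw [← h1]
    refine integral_congr_ae (ae_of_all _ fun x => ?_)
    simp [← Complex.exp_conj]
  have hre : (fun x => (f x).re) =ᵐ[stdGaussian E] 0 := by
    refine ae_eq_zero_of_forall_integral_mul_exp_eq_zero hf.re fun F => ?_
    have h1 : ∫ x, (f x * Complex.exp ((inner ℝ x F : ℝ) * Complex.I) + (starRingEnd ℂ) (f x) *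
        Complex.exp ((inner ℝ x F : ℝ) * Complex.I)) ∂(stdGaussian E) = 0 := by
      rw [integral_add (hI F) (hI' F), hF, hF', add_zero]
    rw [← mul_zero (1 / 2 : ℂ), ← h1, ← integral_const_mul]
    refine integral_congr_ae (ae_of_all _ fun x => ?_)
    simp only [Complex.re_eq_add_conj]
    ring
  have him : (fun x => (f x).im) =ᵐ[stdGaussian E] 0 := by
    refine ae_eq_zero_of_forall_integral_mul_exp_eq_zero hf.im fun F => ?_
    have h1 : ∫ x, (f x * Complex.exp ((inner ℝ x F : ℝ) * Complex.I) - (starRingEnd ℂ) (f x) *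
        Complex.exp ((inner ℝ x F : ℝ) * Complex.I)) ∂(stdGaussian E) = 0 := by
      rw [integral_sub (hI F) (hI' F), hF, hF', sub_zero]
    rw [← mul_zero (1 / (2 * Complex.I) : ℂ), ← h1, ← integral_const_mul]
    refine integral_congr_ae (ae_of_all _ fun x => ?_)
    simp only [Complex.im_eq_sub_conj]
    ring
  refine (Lp.eq_zero_iff_ae_eq_zero).2 ?_
  filter_upwards [hre, him] with x h1 h2
  exact Complex.ext h1 h2

end Completeness

/-! ### Coefficient bounds and weighted square summability. -/

section WeightedSums

variable {ι : Type*} [Fintype ι]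

theorem summable_prod_pow {r : ℝ} (h0 : 0 ≤ r) (h1 : r < 1) :
    Summable fun α : ι → ℕ => r ^ (∑ i, α i) := by
  simp only [← Finset.prod_pow_eq_pow_sum]
  exact summable_prod (fun _ n => r ^ n) (fun _ _ => by positivity)
    fun _ => summable_geometric_of_lt_one h0 h1

theorem weight_eq (q : ℕ) (α : ι → ℕ) :
    weight q α = (∏ i, ((α i).factorial : ℝ)) * (2 ^ q) ^ (∑ i, α i) := by
  simp only [weight, Finset.prod_mul_distrib, pow_mul, Finset.prod_pow_eq_pow_sum]

theorem weight_pos (q : ℕ) (α : ι → ℕ) : 0 < weight q α :=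
  Finset.prod_pos fun i _ => by positivity

theorem sq_prod_sqrt_factorial (α : ι → ℕ) :
    (∏ i, √((α i).factorial : ℝ)) ^ 2 = ∏ i, ((α i).factorial : ℝ) := by
  rw [← Finset.prod_pow]
  exact Finset.prod_congr rfl fun i _ => Real.sq_sqrt (by positivity)

/-- A family with the growth of the coefficients of a Hida distribution, namely
`O(√α! m^|α|)`. -/
def HasCoeffBound (a : (ι → ℕ) → ℂ) (K m : ℝ) : Prop :=
  ∀ α, ‖a α‖ ≤ K * (∏ i, √((α i).factorial : ℝ)) * m ^ (∑ i, α i)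

/-- The weight contains `α!`, which cancels the square of `√α!` and leaves a geometric term.
Dividing by the root of the weight undoes the scaling in `Test.toHilbert`; the conjugate compensates
for the inner product being conjugate-linear in its first argument. -/
theorem HasCoeffBound.norm_div_sq_le {a : (ι → ℕ) → ℂ} {K m : ℝ} (ha : HasCoeffBound a K m)
    (q : ℕ) (α : ι → ℕ) :
    ‖(starRingEnd ℂ) (a α) / (√(weight q α) : ℝ)‖ ^ 2 ≤
      K ^ 2 * (m ^ 2 / 2 ^ q) ^ (∑ i, α i) := by
  have hw := weight_pos q α
  rw [norm_div, div_pow, Complex.norm_conj, Complex.norm_real, Real.norm_eq_abs, sq_abs,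
    Real.sq_sqrt hw.le, div_le_iff₀ hw]
  calc ‖a α‖ ^ 2 ≤ (K * (∏ i, √((α i).factorial : ℝ)) * m ^ (∑ i, α i)) ^ 2 := by
        gcongr
        exact ha α
    _ = _ := by
        rw [mul_pow, mul_pow, sq_prod_sqrt_factorial, weight_eq, div_pow, ← pow_mul, ← pow_mul,
          mul_comm _ 2, ← pow_mul]
        field_simp

theorem HasCoeffBound.memℓp {a : (ι → ℕ) → ℂ} {K m : ℝ} (ha : HasCoeffBound a K m) {q : ℕ}
    (hq : m ^ 2 < 2 ^ q) :
    Memℓp (fun α => (starRingEnd ℂ) (a α) / (√(weight q α) : ℝ)) 2 := by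
  rw [memℓp_gen_iff (by norm_num)]
  simp only [ENNReal.toReal_ofNat, Real.rpow_ofNat]
  refine Summable.of_nonneg_of_le (fun α => by positivity) (fun α => ha.norm_div_sq_le q α)
    ((summable_prod_pow (by positivity) ?_).mul_left _)
  rwa [div_lt_one (by positivity)]

end WeightedSums

/-! ### Distributions given by coefficients, and pointwise chaos series. -/

section Pairing

variable {ι E : Type*} [Fintype ι] [NormedAddCommGroup E] [InnerProductSpace ℝ E]
  [FiniteDimensional ℝ E] [MeasurableSpace E] [BorelSpace E]

omit [FiniteDimensional ℝ E] in
theorem measurable_wickMonomial (b : OrthonormalBasis ι ℝ E) (α : ι → ℕ) :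
    Measurable fun x => (wickMonomial b α x : ℂ) :=
  Complex.measurable_ofReal.comp (continuous_wickMonomial b α).measurable

/-- The inclusion of the test functions into the `q`-th weighted Hilbert space. -/
noncomputable def Test.toHilbertL (b : OrthonormalBasis ι ℝ E) (q : ℕ) :
    Test b →L[ℂ] lp (fun _ : ι → ℕ => ℂ) 2 where
  toLinearMap := Test.toHilbert b q
  cont := continuous_iInf_dom continuous_induced_dom

/-- The Hida distribution with prescribed values `a α` on the Wick monomials. -/
noncomputable def Distribution.ofCoeff (b : OrthonormalBasis ι ℝ E) (q : ℕ) (a : (ι → ℕ) → ℂ)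
    (ha : Memℓp (fun α => (starRingEnd ℂ) (a α) / (√(weight q α) : ℝ)) 2) : Distribution b :=
  ContinuousLinearMap.precomp ℂ (Test.toHilbertL b q)
    (innerSL ℂ (⟨_, ha⟩ : lp (fun _ : ι → ℕ => ℂ) 2))

theorem Distribution.hasSum_ofCoeff (b : OrthonormalBasis ι ℝ E) (q : ℕ) (a : (ι → ℕ) → ℂ)
    (ha : Memℓp (fun α => (starRingEnd ℂ) (a α) / (√(weight q α) : ℝ)) 2) (φ : Test b) :
    HasSum (fun α => chaosCoeff b α (Test.toL2 b φ) * a α) (Distribution.ofCoeff b q a ha φ) := by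
  have h := lp.hasSum_inner (𝕜 := ℂ) (⟨_, ha⟩ : lp (fun _ : ι → ℕ => ℂ) 2) (Test.toHilbert b q φ)
  refine (show (fun α => chaosCoeff b α (Test.toL2 b φ) * a α) = _ from funext fun α => ?_) ▸ h
  have hw : ((√(weight q α) : ℝ) : ℂ) ≠ 0 :=
    Complex.ofReal_ne_zero.2 (Real.sqrt_pos.2 (weight_pos q α)).ne'
  change _ = ((√(weight q α) : ℝ) * chaosCoeff b α (Test.toL2 b φ)) *
    (starRingEnd ℂ) ((starRingEnd ℂ) (a α) / (√(weight q α) : ℝ))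
  rw [map_div₀, Complex.conj_conj, Complex.conj_ofReal]
  field_simp

/-- Distributions converge strongly if their coefficients converge, and are dominated. -/
theorem Distribution.tendsto_ofCoeff (b : OrthonormalBasis ι ℝ E) {q : ℕ} {K m : ℝ}
    (hq : m ^ 2 < 2 ^ q) {X : Type*} {l : Filter X} {a : X → (ι → ℕ) → ℂ} {a₀ : (ι → ℕ) → ℂ}
    (ha : ∀ x, HasCoeffBound (a x) K m) (ha₀ : HasCoeffBound a₀ K m)
    (h : ∀ α, Tendsto (fun x => a x α) l (𝓝 (a₀ α))) :
    Tendsto (fun x => Distribution.ofCoeff b q (a x) ((ha x).memℓp hq)) l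
      (𝓝 (Distribution.ofCoeff b q a₀ (ha₀.memℓp hq))) := by
  -- Precomposition is continuous for the strong topologies, and so is the Riesz map. It remains to
  -- prove norm convergence of the representing vectors.
  refine ((ContinuousLinearMap.precomp ℂ (Test.toHilbertL b q)).continuous.tendsto _).comp ?_
  refine ((innerSL ℂ (E := lp (fun _ : ι → ℕ => ℂ) 2)).continuous.tendsto _).comp ?_
  rw [tendsto_iff_norm_sub_tendsto_zero]
  have hb (x : X) : HasCoeffBound (fun α => a x α - a₀ α) (K + K) m := fun α => by
    refine (norm_sub_le _ _).trans ((add_le_add (ha x α) (ha₀ α)).trans (le_of_eq ?_))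
    ring
  have hsq (x : X) : ‖(⟨_, (ha x).memℓp hq⟩ : lp (fun _ : ι → ℕ => ℂ) 2) - ⟨_, ha₀.memℓp hq⟩‖ ^ 2 =
      ∑' α, ‖(starRingEnd ℂ) (a x α - a₀ α) / (√(weight q α) : ℝ)‖ ^ 2 := by
    have h := lp.norm_rpow_eq_tsum (p := 2) (by norm_num)
      ((⟨_, (ha x).memℓp hq⟩ : lp (fun _ : ι → ℕ => ℂ) 2) - ⟨_, ha₀.memℓp hq⟩)
    simp only [ENNReal.toReal_ofNat, Real.rpow_ofNat] at h
    rw [h]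
    refine tsum_congr fun α => ?_
    rw [map_sub, sub_div]
    rfl
  have hlim : Tendsto (fun x => ∑' α, ‖(starRingEnd ℂ) (a x α - a₀ α) / (√(weight q α) : ℝ)‖ ^ 2) l
      (𝓝 (∑' _ : ι → ℕ, 0)) := by
    refine tendsto_tsum_of_dominated_convergence
      (bound := fun α => (K + K) ^ 2 * (m ^ 2 / 2 ^ q) ^ (∑ i, α i))
      ((summable_prod_pow (by positivity) ?_).mul_left _) (fun α => ?_)
      (Eventually.of_forall fun x α => ?_)
    · rwa [div_lt_one (by positivity)]
    · have h1 := (h α).sub_const (a₀ α)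
      rw [sub_self] at h1
      have h2 := ((((Complex.continuous_conj.tendsto _).comp h1).div_const
        ((√(weight q α) : ℝ) : ℂ)).norm).pow 2
      simpa using h2
    · rw [Real.norm_of_nonneg (by positivity)]
      exact (hb x).norm_div_sq_le q α
  have h3 := hlim.sqrt
  simp only [← hsq, Real.sqrt_sq (norm_nonneg _), tsum_zero, Real.sqrt_zero] at h3
  exact h3

theorem summable_weight_mul_norm_chaosCoeff_sq (b : OrthonormalBasis ι ℝ E) (φ : Test b) (q : ℕ) :
    Summable fun α => weight q α * ‖chaosCoeff b α (Test.toL2 b φ)‖ ^ 2 := by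
  have h := (memℓp_gen_iff (by norm_num)).1 (φ.2 q)
  refine h.congr fun α => ?_
  simp only [weightedCoeff, LinearMap.pi_apply, LinearMap.smul_apply, norm_smul,
    Complex.norm_real, ENNReal.toReal_ofNat, Real.rpow_ofNat, Real.norm_eq_abs, mul_pow, sq_abs,
    Real.sq_sqrt (weight_nonneg q α)]
  rfl

/-- The square of the term is the product of a term of the `q`-th norm of `φ` and one of a geometric
series of ratio `R²/2^q < 1`; the geometric mean is at most the arithmetic mean. -/
theorem summable_norm_chaosCoeff_mul (b : OrthonormalBasis ι ℝ E) (φ : Test b) (R : ℝ) :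
    Summable fun α => ‖chaosCoeff b α (Test.toL2 b φ)‖ *
      ((∏ i, √((α i).factorial : ℝ)) * R ^ (∑ i, α i)) := by
  obtain ⟨q, hq⟩ := pow_unbounded_of_one_lt (R ^ 2) (one_lt_two)
  refine Summable.of_norm_bounded (((summable_weight_mul_norm_chaosCoeff_sq b φ q).add
    (summable_prod_pow (r := R ^ 2 / 2 ^ q) (by positivity)
      (by rwa [div_lt_one (by positivity)]))).div_const 2) fun α => ?_
  set c := ‖chaosCoeff b α (Test.toL2 b φ)‖
  have hA : 0 ≤ weight q α * c ^ 2 := mul_nonneg (weight_nonneg q α) (sq_nonneg c)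
  have hB : 0 ≤ (R ^ 2 / 2 ^ q) ^ (∑ i, α i) := by positivity
  refine abs_le_of_sq_le_sq ?_ (by linarith)
  have h : (c * ((∏ i, √((α i).factorial : ℝ)) * R ^ (∑ i, α i))) ^ 2 =
      (weight q α * c ^ 2) * (R ^ 2 / 2 ^ q) ^ (∑ i, α i) := by
    rw [mul_pow, mul_pow, sq_prod_sqrt_factorial, weight_eq, div_pow, ← pow_mul, ← pow_mul,
      mul_comm _ 2, ← pow_mul]
    field_simp
  rw [h]
  nlinarith [sq_nonneg (weight q α * c ^ 2 - (R ^ 2 / 2 ^ q) ^ (∑ i, α i))]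

/-- The pointwise sum of the chaos decomposition of a test function. -/
noncomputable def Test.toFun (b : OrthonormalBasis ι ℝ E) (φ : Test b) (x : E) : ℂ :=
  ∑' α, chaosCoeff b α (Test.toL2 b φ) * wickMonomial b α x

theorem Test.exists_bound (b : OrthonormalBasis ι ℝ E) (φ : Test b) {δ : ℝ} (hδ : 0 < δ) :
    ∃ K : ℝ, ∀ x, (Summable fun α => ‖chaosCoeff b α (Test.toL2 b φ) * wickMonomial b α x‖) ∧
      ∑' α, ‖chaosCoeff b α (Test.toL2 b φ) * wickMonomial b α x‖ ≤
        K * Real.exp (δ * ‖x‖ ^ 2) := by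
  have hs := summable_norm_chaosCoeff_mul b φ (Real.exp (1 / δ))
  refine ⟨∑' α, ‖chaosCoeff b α (Test.toL2 b φ)‖ *
    ((∏ i, √((α i).factorial : ℝ)) * Real.exp (1 / δ) ^ (∑ i, α i)), fun x => ?_⟩
  have hle (α : ι → ℕ) : ‖chaosCoeff b α (Test.toL2 b φ) * wickMonomial b α x‖ ≤
      ‖chaosCoeff b α (Test.toL2 b φ)‖ *
      ((∏ i, √((α i).factorial : ℝ)) * Real.exp (1 / δ) ^ (∑ i, α i)) *
        Real.exp (δ * ‖x‖ ^ 2) := by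
    rw [norm_mul, Complex.norm_real, mul_assoc]
    gcongr
    exact abs_wickMonomial_le b hδ α x
  have hsum := Summable.of_nonneg_of_le (fun α => norm_nonneg _) hle (hs.mul_right _)
  refine ⟨hsum, (hsum.tsum_le_tsum hle (hs.mul_right _)).trans ?_⟩
  rw [tsum_mul_right]

theorem Test.isGaussianSmall_tsum_norm (b : OrthonormalBasis ι ℝ E) (φ : Test b) :
    IsGaussianSmall fun x =>
      ((∑' α, ‖chaosCoeff b α (Test.toL2 b φ) * wickMonomial b α x‖ : ℝ) : ℂ) := by
  intro δ hδ
  obtain ⟨K, hK⟩ := Test.exists_bound b φ hδ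
  refine ⟨K, fun x => ?_⟩
  rw [Complex.norm_real, Real.norm_of_nonneg (tsum_nonneg fun α => norm_nonneg _)]
  exact (hK x).2

theorem Test.hasSum_toFun (b : OrthonormalBasis ι ℝ E) (φ : Test b) (x : E) :
    HasSum (fun α => chaosCoeff b α (Test.toL2 b φ) * wickMonomial b α x) (Test.toFun b φ x) :=
  let ⟨_, hK⟩ := Test.exists_bound b φ one_pos
  (hK x).1.of_norm.hasSum

theorem Test.isGaussianSmall_toFun (b : OrthonormalBasis ι ℝ E) (φ : Test b) :
    IsGaussianSmall (Test.toFun b φ) := by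
  obtain ⟨_, hK⟩ := Test.exists_bound b φ one_pos
  refine (Test.isGaussianSmall_tsum_norm b φ).mono fun x => ?_
  rw [Complex.norm_real, Real.norm_of_nonneg (tsum_nonneg fun α => norm_nonneg _)]
  exact norm_tsum_le_tsum_norm (hK x).1

theorem Test.aestronglyMeasurable_toFun (b : OrthonormalBasis ι ℝ E) (φ : Test b) :
    AEStronglyMeasurable (Test.toFun b φ) (stdGaussian E) :=
  aestronglyMeasurable_of_tendsto_ae atTop
    (fun s : Finset (ι → ℕ) => Finset.aestronglyMeasurable_fun_sum s fun α _ =>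
      ((measurable_wickMonomial b α).aestronglyMeasurable.const_mul _))
    (ae_of_all _ fun x => Test.hasSum_toFun b φ x)

/-- The sum of the absolute values of the series grows more slowly than every `exp (δ|x|²)`, so
multiplied by `|g|` it is an integrable majorant, without `g` being in `L²`. -/
theorem Test.hasSum_integral_mul_toFun (b : OrthonormalBasis ι ℝ E) (φ : Test b) {g : E → ℂ}
    (hg : HasGaussianBound g) (hm : AEStronglyMeasurable g (stdGaussian E)) :
    HasSum (fun α => chaosCoeff b α (Test.toL2 b φ) *
        ∫ x, g x * wickMonomial b α x ∂(stdGaussian E))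
      (∫ x, g x * Test.toFun b φ x ∂(stdGaussian E)) := by
  obtain ⟨_, hK⟩ := Test.exists_bound b φ one_pos
  have h := hasSum_integral_of_dominated_convergence (μ := stdGaussian E)
    (F := fun α x => g x * (chaosCoeff b α (Test.toL2 b φ) * wickMonomial b α x))
    (f := fun x => g x * Test.toFun b φ x)
    (fun α x => ‖g x‖ * ‖chaosCoeff b α (Test.toL2 b φ) * wickMonomial b α x‖)
    (fun α => hm.mul ((measurable_wickMonomial b α).aestronglyMeasurable.const_mul _))
    (fun α => ae_of_all _ fun x => (norm_mul _ _).le)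
    (ae_of_all _ fun x => (hK x).1.mul_left _)
    (by
      simp only [tsum_mul_left]
      have hmeas : Measurable fun x =>
          ∑' α, ‖chaosCoeff b α (Test.toL2 b φ) * wickMonomial b α x‖ :=
        Measurable.tsum fun α => ((measurable_wickMonomial b α).const_mul _).norm
      refine ((hg.mul (Test.isGaussianSmall_tsum_norm b φ)).integrable
        (hm.mul (Complex.measurable_ofReal.comp hmeas).aestronglyMeasurable)).norm.congr
          (ae_of_all _ fun x => ?_)
      beta_reduce
      rw [norm_mul, Complex.norm_real, Real.norm_of_nonneg (tsum_nonneg fun α => norm_nonneg _)])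
    (ae_of_all _ fun x => (Test.hasSum_toFun b φ x).mul_left _)
  convert! h using 1
  funext α
  rw [← integral_const_mul]
  refine integral_congr_ae (ae_of_all _ fun x => ?_)
  ring

/-- By orthogonality the pointwise sum has the chaos coefficients of `φ`, and completeness shows
that these determine it. -/
theorem Test.toFun_ae_eq (b : OrthonormalBasis ι ℝ E) (φ : Test b) :
    Test.toFun b φ =ᵐ[stdGaussian E] Test.toL2 b φ := by
  have hp : MemLp (Test.toFun b φ) 2 (stdGaussian E) :=
    (Test.isGaussianSmall_toFun b φ).memLp_two (Test.aestronglyMeasurable_toFun b φ)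
  have h0 : hp.toLp _ - Test.toL2 b φ = 0 := by
    refine eq_zero_of_forall_integral_mul_wickMonomial b _ fun β => ?_
    have hβ : (∏ i, ((β i).factorial : ℂ)) ≠ 0 :=
      Finset.prod_ne_zero_iff.2 fun i _ => by exact_mod_cast (β i).factorial_ne_zero
    suffices chaosCoeff b β (hp.toLp _ - Test.toL2 b φ) = 0 by
      simpa [chaosCoeff, hβ] using this
    rw [map_sub, sub_eq_zero]
    have h1 := Test.hasSum_integral_mul_toFun b φ
      (isGaussianSmall_wickMonomial b β).hasGaussianBound
      (measurable_wickMonomial b β).aestronglyMeasurable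
    simp only [integral_wickMonomial_mul_wickMonomial] at h1
    have h2 := h1.unique (hasSum_single β fun α hα => by rw [if_neg hα.symm, mul_zero])
    rw [if_pos rfl] at h2
    have h3 : ∫ x, hp.toLp (Test.toFun b φ) x * (wickMonomial b β x : ℂ) ∂(stdGaussian E) =
        ∫ x, (wickMonomial b β x : ℂ) * Test.toFun b φ x ∂(stdGaussian E) := by
      refine integral_congr_ae ?_
      filter_upwards [hp.coeFn_toLp] with x hx
      rw [hx, mul_comm]
    change (∏ i, ((β i).factorial : ℂ))⁻¹ * _ = _
    rw [h3, h2, mul_comm, mul_assoc, mul_inv_cancel₀ hβ, mul_one]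
  rw [sub_eq_zero] at h0
  rw [← h0]
  exact hp.coeFn_toLp.symm

/-- Functions with a Gaussian bound act on test functions through the chaos coefficients. -/
theorem Test.integrable_and_hasSum (b : OrthonormalBasis ι ℝ E) (φ : Test b) {g : E → ℂ}
    (hg : HasGaussianBound g) (hm : AEStronglyMeasurable g (stdGaussian E)) :
    Integrable (fun x => g x * Test.toL2 b φ x) (stdGaussian E) ∧
    HasSum (fun α => chaosCoeff b α (Test.toL2 b φ) *
        ∫ x, g x * wickMonomial b α x ∂(stdGaussian E))
      (∫ x, g x * Test.toL2 b φ x ∂(stdGaussian E)) := by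
  have hae : (fun x => g x * Test.toFun b φ x) =ᵐ[stdGaussian E]
      fun x => g x * Test.toL2 b φ x := by
    filter_upwards [Test.toFun_ae_eq b φ] with x hx
    rw [hx]
  refine ⟨((hg.mul (Test.isGaussianSmall_toFun b φ)).integrable
    (hm.mul (Test.aestronglyMeasurable_toFun b φ))).congr hae, ?_⟩
  rw [← integral_congr_ae hae]
  exact Test.hasSum_integral_mul_toFun b φ hg hm

theorem Distribution.isGivenBy_ofCoeff (b : OrthonormalBasis ι ℝ E) {g : E → ℂ}
    (hg : HasGaussianBound g) (hm : AEStronglyMeasurable g (stdGaussian E)) (q : ℕ)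
    (a : (ι → ℕ) → ℂ) (ha : Memℓp (fun α => (starRingEnd ℂ) (a α) / (√(weight q α) : ℝ)) 2)
    (hag : ∀ α, a α = ∫ x, g x * wickMonomial b α x ∂(stdGaussian E)) :
    IsGivenBy (Distribution.ofCoeff b q a ha) g := fun φ => by
  have h := Test.integrable_and_hasSum b φ hg hm
  simp only [← hag] at h
  exact ⟨h.1, (Distribution.hasSum_ofCoeff b q a ha φ).unique h.2⟩

end Pairing

/-! ### Bounds and limits from a two-step recursion. -/

section Recursion

variable {ι : Type*} [Fintype ι] [DecidableEq ι]

theorem sum_sub_single_add_one {α : ι → ℕ} {i : ι} (hi : 0 < α i) :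
    ∑ j, (α - Pi.single i 1 : ι → ℕ) j + 1 = ∑ j, α j := by
  have h : ∑ j, ((α - Pi.single i 1 : ι → ℕ) j + (Pi.single i 1 : ι → ℕ) j) = ∑ j, α j := by
    refine Finset.sum_congr rfl fun j _ => ?_
    by_cases hj : j = i
    · subst hj
      simp
      omega
    · simp [hj]
  rw [← h, Finset.sum_add_distrib]
  simp

theorem prod_sqrt_factorial_sub_single {α : ι → ℕ} {i : ι} (hi : 0 < α i) :
    √(α i : ℝ) * ∏ j, √(((α - Pi.single i 1 : ι → ℕ) j).factorial : ℝ) =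
      ∏ j, √((α j).factorial : ℝ) := by
  rw [prod_pi_sub_single (fun _ n => √(n.factorial : ℝ)), ← mul_assoc,
    ← Finset.mul_prod_erase _ (fun j => √((α j).factorial : ℝ)) (Finset.mem_univ i),
    ← Real.sqrt_mul (by positivity)]
  congr 2
  exact_mod_cast Nat.mul_factorial_pred hi.ne'

/-- The growth of the coefficients of a Gaussian exponential, from their two-step recursion. -/
theorem hasCoeffBound_of_recursion {a : (ι → ℕ) → ℂ} {M : ι → ι → ℂ} (hM : ∀ i j, ‖M i j‖ ≤ 2)
    (h : ∀ (α : ι → ℕ) (i : ι), a (α + Pi.single i 1) = ∑ j, M i j * (α j * a (α - Pi.single j 1))) :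
    HasCoeffBound a ‖a 0‖ (2 * Fintype.card ι + 1) := by
  set m : ℝ := 2 * Fintype.card ι + 1 with hm
  have hm1 : 1 ≤ m := by
    rw [hm]
    linarith [show (0 : ℝ) ≤ Fintype.card ι by positivity]
  intro α
  induction hn : ∑ i, α i using Nat.strong_induction_on generalizing α with
  | _ n ih =>
  rcases eq_zero_or_eq_add_single α with rfl | ⟨γ, k, hγ⟩
  · subst hn
    simp
  have : Nonempty ι := ⟨k⟩
  -- The unit is removed at a largest entry, so that every `β j` below is at most `α i`.
  obtain ⟨i, hi⟩ := Finite.exists_max α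
  have hi0 : 0 < α i := by
    have h1 := hi k
    rw [hγ] at h1
    simp only [Pi.add_apply, Pi.single_eq_same] at h1
    rw [hγ]
    simp only [Pi.add_apply]
    omega
  set β : ι → ℕ := α - Pi.single i 1 with hβ
  have hαβ : α = β + Pi.single i 1 := by
    ext j
    by_cases hj : j = i
    · subst hj
      simp [hβ]
      omega
    · simp [hβ, hj]
  have hsum : ∑ j, β j + 1 = n := by rw [hβ, sum_sub_single_add_one hi0, hn]
  have hterm (j : ι) : ‖M i j * (β j * a (β - Pi.single j 1))‖ ≤
      2 * (‖a 0‖ * (∏ i, √((α i).factorial : ℝ)) * m ^ (n - 1)) := by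
    rw [norm_mul, norm_mul, Complex.norm_natCast]
    refine mul_le_mul (hM i j) ?_ (by positivity) (by norm_num)
    rcases Nat.eq_zero_or_pos (β j) with h0 | h0
    · rw [h0, Nat.cast_zero, zero_mul]
      positivity
    have hs := sum_sub_single_add_one h0
    have hβα : β j ≤ α i := (by simp [hβ] : β j ≤ α j).trans (hi j)
    calc (β j : ℝ) * ‖a (β - Pi.single j 1)‖
        ≤ β j * (‖a 0‖ * (∏ k, √(((β - Pi.single j 1 : ι → ℕ) k).factorial : ℝ)) *
          m ^ (∑ k, (β - Pi.single j 1 : ι → ℕ) k)) := by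
          gcongr
          exact ih _ (by omega) _ rfl
      -- The degree here is `n - 2`; raising the exponent to `n - 1` uses `1 ≤ m`.
      _ ≤ β j * (‖a 0‖ * (∏ k, √(((β - Pi.single j 1 : ι → ℕ) k).factorial : ℝ)) *
          m ^ (n - 1)) := by
          gcongr
          omega
      _ = √(β j : ℝ) * (√(β j : ℝ) *
            ∏ k, √(((β - Pi.single j 1 : ι → ℕ) k).factorial : ℝ)) * ‖a 0‖ * m ^ (n - 1) := by
          nth_rewrite 1 [← Real.mul_self_sqrt (show (0 : ℝ) ≤ β j by positivity)]
          ring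
      -- Of the two factors `√(β j)`, one restores the factorials of `β`; the other is enlarged to
      -- `√(α i)`, which restores those of `α`.
      _ ≤ √(α i : ℝ) * (√(β j : ℝ) *
            ∏ k, √(((β - Pi.single j 1 : ι → ℕ) k).factorial : ℝ)) * ‖a 0‖ * m ^ (n - 1) := by
          gcongr
      _ = ‖a 0‖ * (√(α i : ℝ) * ∏ k, √((β k).factorial : ℝ)) * m ^ (n - 1) := by
          rw [prod_sqrt_factorial_sub_single h0]
          ring
      _ = _ := by rw [hβ, prod_sqrt_factorial_sub_single hi0]
  calc ‖a α‖ = ‖∑ j, M i j * (β j * a (β - Pi.single j 1))‖ := by rw [← h, ← hαβ]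
    _ ≤ ∑ _j : ι, 2 * (‖a 0‖ * (∏ i, √((α i).factorial : ℝ)) * m ^ (n - 1)) :=
        norm_sum_le_of_le _ fun j _ => hterm j
    _ = (2 * Fintype.card ι) * (‖a 0‖ * (∏ i, √((α i).factorial : ℝ)) * m ^ (n - 1)) := by
        rw [Finset.sum_const, Finset.card_univ, nsmul_eq_mul]
        ring
    _ ≤ m * (‖a 0‖ * (∏ i, √((α i).factorial : ℝ)) * m ^ (n - 1)) := by
        gcongr
        rw [hm]
        linarith
    _ = ‖a 0‖ * (∏ i, √((α i).factorial : ℝ)) * m ^ n := by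
        rw [← hsum, Nat.add_sub_cancel, pow_succ]
        ring

/-- Existence of the limits suffices: the limit distribution is later evaluated through its
`T`-transform, so no closed formula for its coefficients is needed. -/
theorem exists_tendsto_of_recursion {X : Type*} {l : Filter X} {a : X → (ι → ℕ) → ℂ}
    {M : X → ι → ι → ℂ} {M₀ : ι → ι → ℂ} {c : ℂ}
    (hM : ∀ i j, Tendsto (fun x => M x i j) l (𝓝 (M₀ i j)))
    (h0 : Tendsto (fun x => a x 0) l (𝓝 c))
    (h : ∀ᶠ x in l, ∀ (α : ι → ℕ) (i : ι),
      a x (α + Pi.single i 1) = ∑ j, M x i j * (α j * a x (α - Pi.single j 1))) (α : ι → ℕ) :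
    ∃ y, Tendsto (fun x => a x α) l (𝓝 y) := by
  induction hn : ∑ i, α i using Nat.strong_induction_on generalizing α with
  | _ n ih =>
  rcases eq_zero_or_eq_add_single α with rfl | ⟨β, i, rfl⟩
  · exact ⟨c, h0⟩
  have hβ : ∑ j, β j + 1 = n := by simp [← hn, Finset.sum_add_distrib]
  have hex (j : ι) : ∃ y, Tendsto (fun x => M x i j * (β j * a x (β - Pi.single j 1))) l (𝓝 y) := by
    rcases Nat.eq_zero_or_pos (β j) with hj | hj
    · exact ⟨0, by simpa [hj] using tendsto_const_nhds⟩
    · have := sum_sub_single_add_one hj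
      obtain ⟨y, hy⟩ := ih _ (by omega) (β - Pi.single j 1) rfl
      exact ⟨_, (hM i j).mul (hy.const_mul _)⟩
  choose y hy using hex
  refine ⟨∑ j, y j, (tendsto_finsetSum _ fun j _ => hy j).congr' ?_⟩
  filter_upwards [h] with x hx
  rw [hx]

end Recursion

/-! ### Solving the linear system of the recursion. -/

section Resolvent

variable {ι : Type*} [Fintype ι] [DecidableEq ι]

/-- The matrix of the two-step recursion for the coefficients of
`exp (½ ((1 - ε) |x|² + i ⟨x, S x⟩))`, where `T` is the matrix of the involution `S`. -/
noncomputable def recursionMatrix (T : Matrix ι ι ℂ) (ε : ℝ) : Matrix ι ι ℂ :=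
  (1 + (ε : ℂ) ^ 2)⁻¹ • ((ε * (1 - ε) - 1 : ℂ) • (1 : Matrix ι ι ℂ) + Complex.I • T)

theorem eq_recursionMatrix_mulVec {T : Matrix ι ι ℂ} (hT : T * T = 1) {ε : ℝ} {p l : ι → ℂ}
    (h : p = (1 - ε : ℂ) • (p + l) + Complex.I • T.mulVec (p + l)) :
    p = (recursionMatrix T ε).mulVec l := by
  have hε : (1 + (ε : ℂ) ^ 2) ≠ 0 := by
    have : (0 : ℝ) < 1 + ε ^ 2 := by positivity
    exact_mod_cast this.ne'
  have h2 := congrArg T.mulVec h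
  simp only [Matrix.mulVec_add, Matrix.mulVec_smul, Matrix.mulVec_mulVec, hT, Matrix.one_mulVec]
    at h2
  rw [recursionMatrix, Matrix.smul_mulVec, Matrix.add_mulVec, Matrix.smul_mulVec,
    Matrix.smul_mulVec, Matrix.one_mulVec, eq_inv_smul_iff₀ hε]
  rw [Matrix.mulVec_add] at h
  funext i
  have e1 := congrFun h i
  have e2 := congrFun h2 i
  simp only [Pi.add_apply, Pi.smul_apply, smul_eq_mul] at e1 e2 ⊢
  -- The system reads `(ε - iT) p = (1 - ε + iT) l`. Multiplying by `ε + iT` turns the left side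
  -- into `(1 + ε²) p`, because `T² = 1`.
  linear_combination ε * e1 + Complex.I * e2 + (p i + l i) * Complex.I_sq

omit [Fintype ι] in
theorem norm_recursionMatrix_le {T : Matrix ι ι ℂ} (hT : ∀ i j, ‖T i j‖ ≤ 1) {ε : ℝ} (hε : 0 < ε)
    (i j : ι) : ‖recursionMatrix T ε i j‖ ≤ 2 := by
  have h1 : ‖(1 + (ε : ℂ) ^ 2)⁻¹‖ = (1 + ε ^ 2)⁻¹ := by
    rw [norm_inv]
    norm_cast
    rw [Real.norm_of_nonneg (by positivity)]
  -- The norm is `ε² - ε + 1`, and `ε` is positive. Together with at most `1` from `iT` this gives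
  -- at most `2 + ε² ≤ 2 (1 + ε²)`.
  have h2 : ‖(ε * (1 - ε) - 1 : ℂ)‖ ≤ 1 + ε ^ 2 := by
    norm_cast
    rw [Real.norm_eq_abs, abs_le]
    constructor <;> nlinarith [sq_nonneg (ε - 1)]
  have h3 : ‖(1 : Matrix ι ι ℂ) i j‖ ≤ 1 := by
    rw [Matrix.one_apply]
    split_ifs <;> simp
  simp only [recursionMatrix, Matrix.smul_apply, Matrix.add_apply, smul_eq_mul]
  rw [norm_mul, h1, inv_mul_le_iff₀ (by positivity)]
  refine (norm_add_le _ _).trans ?_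
  rw [norm_mul, norm_mul, Complex.norm_I, one_mul]
  nlinarith [hT i j, sq_nonneg ε, norm_nonneg ((1 : Matrix ι ι ℂ) i j),
    mul_le_mul h2 h3 (norm_nonneg _) (by positivity)]

omit [Fintype ι] in
theorem tendsto_recursionMatrix (T : Matrix ι ι ℂ) (i j : ι) :
    Tendsto (fun ε => recursionMatrix T ε i j) (𝓝[>] 0) (𝓝 (recursionMatrix T 0 i j)) := by
  refine tendsto_nhdsWithin_of_tendsto_nhds (Continuous.tendsto ?_ 0)
  simp only [recursionMatrix, Matrix.smul_apply, Matrix.add_apply, smul_eq_mul]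
  have : ∀ ε : ℝ, (1 + (ε : ℂ) ^ 2) ≠ 0 := fun ε => by
    have : (0 : ℝ) < 1 + ε ^ 2 := by positivity
    exact_mod_cast this.ne'
  fun_prop (disch := exact this _)

end Resolvent

/-! ### One-dimensional complex Gaussian integrals. -/

section GaussianIntegral

/-- A complex Gaussian integral with respect to the standard Gaussian measure on the line. -/
theorem integral_gaussianReal_cexp {z : ℂ} (hz : 0 < z.re) (h : ℝ) :
    ∫ x : ℝ, Complex.exp (1 / 2 * (1 - z) * x ^ 2 + Complex.I * (x * h)) ∂(gaussianReal 0 1) =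
      (1 / z) ^ (1 / 2 : ℂ) * Complex.exp (-h ^ 2 / (2 * z)) := by
  have hz0 : z ≠ 0 := by
    rintro rfl
    simp at hz
  rw [integral_gaussianReal_eq_integral_smul one_ne_zero]
  have h1 (x : ℝ) : gaussianPDFReal 0 1 x •
      Complex.exp (1 / 2 * (1 - z) * x ^ 2 + Complex.I * (x * h)) =
      ((√(2 * Real.pi))⁻¹ : ℝ) *
        Complex.exp (-(z / 2) * x ^ 2 + (Complex.I * h) * x + 0) := by
    rw [gaussianPDFReal, Complex.real_smul]
    push_cast
    rw [mul_assoc, ← Complex.exp_add]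
    simp only [mul_one]
    congr 2
    ring
  simp only [h1]
  rw [integral_const_mul, integral_cexp_quadratic (by simpa using hz), ← mul_assoc]
  congr 1
  · have h2 : (Real.pi : ℂ) / -(-(z / 2)) = ((2 * Real.pi : ℝ) : ℂ) * (1 / z) := by
      push_cast
      field_simp
    have hpi : (0 : ℝ) < 2 * Real.pi := by positivity
    -- The complex square root of the product splits because the factor `2π` is a positive real, for
    -- which the logarithm is additive.
    rw [h2, Complex.cpow_def_of_ne_zero (by simp [Real.pi_ne_zero, hz0]),
      Complex.log_ofReal_mul hpi (one_div_ne_zero hz0), add_mul, Complex.exp_add, ← mul_assoc,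
      Complex.cpow_def_of_ne_zero (one_div_ne_zero hz0), Real.sqrt_eq_rpow,
      Real.rpow_def_of_pos hpi]
    have h3 : Complex.exp (Real.log (2 * Real.pi) * (1 / 2)) =
        ((Real.exp (Real.log (2 * Real.pi) * (1 / 2)) : ℝ) : ℂ) := by
      push_cast
      rfl
    rw [h3, ← Complex.ofReal_mul, inv_mul_cancel₀ (Real.exp_ne_zero _), Complex.ofReal_one, one_mul]
  · congr 1
    rw [mul_pow, Complex.I_sq]
    field_simp
    ring

end GaussianIntegral

/-! ### The quadratic exponential and its coefficients. -/

section QuadraticExponential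

variable {ι E : Type*} [Fintype ι] [NormedAddCommGroup E] [InnerProductSpace ℝ E]

/-- The exponential `exp (½ ((1 - ε) |x|² + i ⟨x, S x⟩))`. -/
noncomputable def quadExp (S : E →ₗ[ℝ] E) (ε : ℝ) (x : E) : ℂ :=
  Complex.exp (1 / 2 * ((1 - ε) * (‖x‖ : ℂ) ^ 2 + Complex.I * (inner ℝ x (S x) : ℝ)))

theorem norm_quadExp (S : E →ₗ[ℝ] E) (ε : ℝ) (x : E) :
    ‖quadExp S ε x‖ = Real.exp ((1 - ε) / 2 * ‖x‖ ^ 2) := by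
  have h : 1 / 2 * ((1 - ε) * (‖x‖ : ℂ) ^ 2 + Complex.I * (inner ℝ x (S x) : ℝ)) =
      (((1 - ε) / 2 * ‖x‖ ^ 2 : ℝ) : ℂ) + ((inner ℝ x (S x) / 2 : ℝ) : ℂ) * Complex.I := by
    push_cast
    ring
  rw [quadExp, h, Complex.exp_add, norm_mul, Complex.norm_exp_ofReal_mul_I, mul_one,
    Complex.norm_exp, Complex.ofReal_re]

/-- The exponent `(1 - ε)/2` tends to `1/2`, so this only handles each `ε` separately; estimates
uniform in `ε` come from the recursion. -/
theorem hasGaussianBound_quadExp (S : E →ₗ[ℝ] E) {ε : ℝ} (hε : 0 < ε) :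
    HasGaussianBound (quadExp S ε) :=
  ⟨1, (1 - ε) / 2, by linarith, fun x => by rw [norm_quadExp, one_mul]⟩

/-- The matrix of an operator in an orthonormal basis, with complex entries. -/
noncomputable def cMatrix (b : OrthonormalBasis ι ℝ E) (S : E →ₗ[ℝ] E) : Matrix ι ι ℂ :=
  Matrix.of fun i j => ((inner ℝ (b i) (S (b j)) : ℝ) : ℂ)

theorem cMatrix_mul_self [DecidableEq ι] (b : OrthonormalBasis ι ℝ E) {S : E →ₗ[ℝ] E}
    (hS : S.IsSymmetric) (hS2 : ∀ x, S (S x) = x) : cMatrix b S * cMatrix b S = 1 := by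
  ext i k
  have h : ∑ j, inner ℝ (b i) (S (b j)) * inner ℝ (b j) (S (b k)) = if i = k then (1 : ℝ) else 0 := by
    simp only [← hS (b i)]
    rw [b.sum_inner_mul_inner, hS, hS2, b.inner_eq_ite]
  rw [Matrix.mul_apply, Matrix.one_apply]
  simp only [cMatrix, Matrix.of_apply]
  rw [show (if i = k then (1 : ℂ) else 0) = ((if i = k then 1 else 0 : ℝ) : ℂ) by
    split_ifs <;> simp, ← h]
  push_cast
  rfl

theorem norm_cMatrix_le (b : OrthonormalBasis ι ℝ E) {S : E →ₗ[ℝ] E}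
    (hS : S.IsSymmetric) (hS2 : ∀ x, S (S x) = x) (i j : ι) : ‖cMatrix b S i j‖ ≤ 1 := by
  have h : ‖S (b j)‖ = 1 := by
    rw [← sq_eq_sq₀ (norm_nonneg _) zero_le_one, ← real_inner_self_eq_norm_sq, hS, hS2,
      real_inner_self_eq_norm_sq, b.norm_eq_one]
  rw [cMatrix, Matrix.of_apply, Complex.norm_real]
  refine (norm_inner_le_norm _ _).trans ?_
  rw [h, b.norm_eq_one, one_mul]

theorem hasLineDerivAt_quadExp {S : E →ₗ[ℝ] E} (hS : S.IsSymmetric) (ε : ℝ) (x v : E) :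
    HasLineDerivAt ℝ (quadExp S ε)
      (quadExp S ε x * ((1 - ε) * (inner ℝ v x : ℝ) + Complex.I * (inner ℝ v (S x) : ℝ))) x v := by
  have h1 : HasDerivAt (fun t : ℝ => inner ℝ (x + t • v) (x + t • v)) (2 * inner ℝ v x) 0 := by
    have e : (fun t : ℝ => inner ℝ (x + t • v) (x + t • v)) =
        fun t : ℝ => inner ℝ x x + t * (2 * inner ℝ v x) + t ^ 2 * inner ℝ v v := by
      funext t
      simp only [inner_add_left, inner_add_right, real_inner_smul_left, real_inner_smul_right,
        real_inner_comm x v]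
      ring
    rw [e]
    have := (((hasDerivAt_id (0 : ℝ)).mul_const (2 * inner ℝ v x)).const_add (inner ℝ x x)).add
      (((hasDerivAt_id (0 : ℝ)).pow 2).mul_const (inner ℝ v v))
    refine this.congr_deriv ?_
    simp
  have h2 : HasDerivAt (fun t : ℝ => inner ℝ (x + t • v) (S (x + t • v))) (2 * inner ℝ v (S x))
      0 := by
    have e : (fun t : ℝ => inner ℝ (x + t • v) (S (x + t • v))) =
        fun t : ℝ => inner ℝ x (S x) + t * (2 * inner ℝ v (S x)) + t ^ 2 * inner ℝ v (S v) := by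
      funext t
      have e1 : inner ℝ x (S v) = inner ℝ v (S x) := by
        rw [← hS x v, real_inner_comm]
      simp only [map_add, map_smul, inner_add_left, inner_add_right, real_inner_smul_left,
        real_inner_smul_right, e1]
      ring
    rw [e]
    have := (((hasDerivAt_id (0 : ℝ)).mul_const (2 * inner ℝ v (S x))).const_add
      (inner ℝ x (S x))).add (((hasDerivAt_id (0 : ℝ)).pow 2).mul_const (inner ℝ v (S v)))
    refine this.congr_deriv ?_
    simp
  have h3 := (((h1.ofReal_comp.const_mul (1 - ε : ℂ)).add
    (h2.ofReal_comp.const_mul Complex.I)).const_mul (1 / 2 : ℂ)).cexp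
  have e : (fun t : ℝ => quadExp S ε (x + t • v)) = fun t : ℝ =>
      Complex.exp (1 / 2 * ((1 - ε) * ((inner ℝ (x + t • v) (x + t • v) : ℝ) : ℂ) +
        Complex.I * (inner ℝ (x + t • v) (S (x + t • v)) : ℝ))) := by
    funext t
    rw [quadExp, real_inner_self_eq_norm_sq (x + t • v)]
    push_cast
    rfl
  rw [HasLineDerivAt, e]
  refine h3.congr_deriv ?_
  simp only [Pi.add_apply, zero_smul, add_zero, quadExp, real_inner_self_eq_norm_sq]
  push_cast
  ring

variable [FiniteDimensional ℝ E]

theorem continuous_quadExp (S : E →ₗ[ℝ] E) (ε : ℝ) : Continuous (quadExp S ε) := by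
  have := S.continuous_of_finiteDimensional
  unfold quadExp
  fun_prop

variable [MeasurableSpace E] [BorelSpace E]

/-- The values of the distribution given by `quadExp S ε` on the Wick monomials. -/
noncomputable def quadCoeff (b : OrthonormalBasis ι ℝ E) (S : E →ₗ[ℝ] E) (ε : ℝ) (α : ι → ℕ) : ℂ :=
  ∫ x, quadExp S ε x * wickMonomial b α x ∂(stdGaussian E)

theorem integrable_quadExp_mul_wickMonomial (b : OrthonormalBasis ι ℝ E) (S : E →ₗ[ℝ] E) {ε : ℝ}
    (hε : 0 < ε) (α : ι → ℕ) :
    Integrable (fun x => quadExp S ε x * wickMonomial b α x) (stdGaussian E) := by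
  have h1 := continuous_quadExp S ε
  have h2 := continuous_wickMonomial b α
  exact ((hasGaussianBound_quadExp S hε).mul (isGaussianSmall_wickMonomial b α)).integrable
    (by fun_prop)

theorem quadCoeff_add_single [DecidableEq ι] (b : OrthonormalBasis ι ℝ E) {S : E →ₗ[ℝ] E}
    (hS : S.IsSymmetric) (hS2 : ∀ x, S (S x) = x) {ε : ℝ} (hε : 0 < ε) (α : ι → ℕ) (i : ι) :
    quadCoeff b S ε (α + Pi.single i 1) =
      ∑ j, recursionMatrix (cMatrix b S) ε i j * (α j * quadCoeff b S ε (α - Pi.single j 1)) := by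
  set p : ι → ℂ := fun j => quadCoeff b S ε (α + Pi.single j 1) with hp
  set l : ι → ℂ := fun j => α j * quadCoeff b S ε (α - Pi.single j 1) with hl
  have hI (j : ι) : Integrable (fun x => quadExp S ε x * ((inner ℝ (b j) x : ℝ) *
      wickMonomial b α x)) (stdGaussian E) ∧
      ∫ x, quadExp S ε x * ((inner ℝ (b j) x : ℝ) * wickMonomial b α x) ∂(stdGaussian E) =
        (p + l) j := by
    have h1 := integrable_quadExp_mul_wickMonomial b S hε (α + Pi.single j 1)
    have h2 := (integrable_quadExp_mul_wickMonomial b S hε (α - Pi.single j 1)).const_mul (α j : ℂ)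
    have e (x : E) : quadExp S ε x * ((inner ℝ (b j) x : ℝ) * wickMonomial b α x) =
        quadExp S ε x * wickMonomial b (α + Pi.single j 1) x +
          α j * (quadExp S ε x * wickMonomial b (α - Pi.single j 1) x) := by
      rw [← Complex.ofReal_mul, inner_mul_wickMonomial]
      push_cast
      ring
    simp only [e]
    refine ⟨h1.fun_add h2, ?_⟩
    rw [integral_add h1 h2, integral_const_mul]
    rfl
  have hSc := S.continuous_of_finiteDimensional
  have hq := continuous_quadExp S ε
  have hsmall (v : E) : IsGaussianSmall fun x => ((inner ℝ v (S x) : ℝ) : ℂ) := by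
    simp only [← hS v]
    exact isGaussianSmall_inner (S v)
  have hq0 := hasGaussianBound_quadExp S hε
  -- The entries of `p + l` are the integrals against `x_j :x^α:`. The gradient of `quadExp S ε` is
  -- `(1 - ε) x + i S x` times itself, so integration by parts closes the system.
  have hstein (i : ι) : p i = ((1 - ε : ℂ) • (p + l) +
      Complex.I • (cMatrix b S).mulVec (p + l)) i := by
    have hbound : HasGaussianBound fun x => quadExp S ε x * ((1 - ε) * (inner ℝ (b i) x : ℝ) +
        Complex.I * (inner ℝ (b i) (S x) : ℝ)) := by
      simp only [mul_add]
      exact (hq0.mul ((isGaussianSmall_const _).mul (isGaussianSmall_inner _))).add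
        (hq0.mul ((isGaussianSmall_const _).mul (hsmall _)))
    have h1 := integral_mul_wickMonomial_add_single b (g := quadExp S ε) (i := i)
      (fun x => hasLineDerivAt_quadExp hS ε x (b i)) hq (by fun_prop) hq0 hbound α
    have e (x : E) : quadExp S ε x * ((1 - ε) * (inner ℝ (b i) x : ℝ) +
        Complex.I * (inner ℝ (b i) (S x) : ℝ)) * wickMonomial b α x =
        (1 - ε) * (quadExp S ε x * ((inner ℝ (b i) x : ℝ) * wickMonomial b α x)) +
        ∑ j, Complex.I * cMatrix b S i j *
          (quadExp S ε x * ((inner ℝ (b j) x : ℝ) * wickMonomial b α x)) := by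
      have e1 : ((inner ℝ (b i) (S x) : ℝ) : ℂ) =
          ∑ j, cMatrix b S i j * (inner ℝ (b j) x : ℝ) := by
        simp only [cMatrix, Matrix.of_apply, ← hS (b i)]
        exact_mod_cast (b.sum_inner_mul_inner (S (b i)) x).symm
      rw [e1, mul_add, add_mul, Finset.mul_sum, Finset.mul_sum, Finset.sum_mul]
      congr 1
      · ring
      · refine Finset.sum_congr rfl fun j _ => ?_
        ring
    simp only [e] at h1
    have hJ (j : ι) := (hI j).1.const_mul (Complex.I * cMatrix b S i j)
    rw [integral_add ((hI i).1.const_mul _) (integrable_finsetSum _ fun j _ => hJ j),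
      integral_const_mul, integral_finsetSum _ fun j _ => hJ j, (hI i).2] at h1
    simp only [integral_const_mul, (hI _).2] at h1
    refine (show p i = _ from h1).trans ?_
    simp only [Pi.add_apply, Pi.smul_apply, smul_eq_mul, Matrix.mulVec, dotProduct, Finset.mul_sum,
      mul_assoc]
  exact congrFun (eq_recursionMatrix_mulVec (cMatrix_mul_self b hS hS2) (funext hstein)) i

end QuadraticExponential

/-! ### The `T`-transform and the strong limit. -/

section Transform

variable {ι E : Type*} [Fintype ι] [NormedAddCommGroup E] [InnerProductSpace ℝ E]
  [FiniteDimensional ℝ E] [MeasurableSpace E] [BorelSpace E]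

theorem integral_quadExp_mul_exp (e : OrthonormalBasis ι ℝ E) {S : E →ₗ[ℝ] E} {c : ι → ℝ}
    (he : ∀ k, S (e k) = c k • e k) {ε : ℝ} (hε : 0 < ε) (F : E) :
    ∫ x, quadExp S ε x * Complex.exp (Complex.I * (inner ℝ x F : ℝ)) ∂(stdGaussian E) =
      ∏ k, ((1 / (ε - Complex.I * c k)) ^ (1 / 2 : ℂ) *
        Complex.exp (-(inner ℝ (e k) F : ℝ) ^ 2 / (2 * (ε - Complex.I * c k)))) := by
  classical
  have hz (k : ι) : 0 < ((ε : ℂ) - Complex.I * c k).re := by simpa using hε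
  have hm : Measurable fun x : ι → ℝ => ∑ i, x i • e i := by fun_prop
  have hq := continuous_quadExp S ε
  rw [stdGaussian_eq_map_pi_orthonormalBasis e, integral_map hm.aemeasurable (by fun_prop)]
  simp only [← integral_gaussianReal_cexp (hz _)]
  rw [← integral_fintype_prod_eq_prod (𝕜 := ℂ) fun k (x : ℝ) =>
    Complex.exp (1 / 2 * (1 - ((ε : ℂ) - Complex.I * c k)) * x ^ 2 +
      Complex.I * (x * (inner ℝ (e k) F : ℝ)))]
  refine integral_congr_ae (ae_of_all _ fun x => ?_)
  have h1 : ‖∑ i, x i • e i‖ ^ 2 = ∑ i, x i ^ 2 := by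
    rw [← real_inner_self_eq_norm_sq]
    simp only [sum_inner, inner_sum, real_inner_smul_left, real_inner_smul_right, e.inner_eq_ite]
    simp [sq]
  have h2 : inner ℝ (∑ i, x i • e i) (S (∑ i, x i • e i)) = ∑ i, c i * x i ^ 2 := by
    simp only [map_sum, map_smul, he, sum_inner, inner_sum, real_inner_smul_left,
      real_inner_smul_right, e.inner_eq_ite]
    refine Finset.sum_congr rfl fun i _ => ?_
    simp
    ring
  have h3 : inner ℝ (∑ i, x i • e i) F = ∑ i, x i * inner ℝ (e i) F := by
    simp [sum_inner, real_inner_smul_left]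
  beta_reduce
  rw [quadExp, ← Complex.exp_add, ← Complex.exp_sum, ← Complex.ofReal_pow, h1, h2, h3]
  congr 1
  push_cast
  rw [Finset.mul_sum, Finset.mul_sum, Finset.mul_sum, ← Finset.sum_add_distrib, Finset.mul_sum,
    ← Finset.sum_add_distrib]
  refine Finset.sum_congr rfl fun k _ => ?_
  ring

/-- Each factor `(ε - i c_k)^{-1/2}` has norm at most `1`, since the imaginary part of its base has
absolute value `1`. This bounds the initial value of the recursion uniformly in `ε`. -/
theorem norm_integral_quadExp_le (e : OrthonormalBasis ι ℝ E) {S : E →ₗ[ℝ] E} {c : ι → ℝ}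
    (he : ∀ k, S (e k) = c k • e k) (hc : ∀ k, |c k| = 1) {ε : ℝ} (hε : 0 < ε) :
    ‖∫ x, quadExp S ε x ∂(stdGaussian E)‖ ≤ 1 := by
  have h := integral_quadExp_mul_exp e he hε 0
  simp only [inner_zero_right, Complex.ofReal_zero, mul_zero, Complex.exp_zero, mul_one, ne_eq,
    OfNat.ofNat_ne_zero, not_false_eq_true, zero_pow, neg_zero, zero_div] at h
  rw [h, norm_prod]
  refine Finset.prod_le_one (fun _ _ => norm_nonneg _) fun k _ => ?_
  have h1 : (1 : ℝ) ≤ ‖(ε : ℂ) - Complex.I * c k‖ := by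
    have := Complex.abs_im_le_norm ((ε : ℂ) - Complex.I * c k)
    simpa [hc k] using this
  have hz0 : (ε : ℂ) - Complex.I * c k ≠ 0 := norm_pos_iff.1 (zero_lt_one.trans_le h1)
  rw [show (1 / 2 : ℂ) = ((1 / 2 : ℝ) : ℂ) by norm_num, Complex.norm_cpow_real, norm_div, norm_one]
  exact Real.rpow_le_one (by positivity) (by rw [div_le_one (by positivity)]; exact h1)
    (by norm_num)

theorem tendsto_integral_quadExp_mul_exp (e : OrthonormalBasis ι ℝ E) {S : E →ₗ[ℝ] E} {c : ι → ℝ}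
    (he : ∀ k, S (e k) = c k • e k) (hc : ∀ k, c k = 1 ∨ c k = -1) (hsum : ∑ k, c k = 0) (F : E) :
    Tendsto (fun ε : ℝ =>
      ∫ x, quadExp S ε x * Complex.exp (Complex.I * (inner ℝ x F : ℝ)) ∂(stdGaussian E))
      (𝓝[>] 0) (𝓝 (Complex.exp (-(Complex.I / 2) * (inner ℝ F (S F) : ℝ)))) := by
  have hlim : Tendsto (fun ε : ℝ => ∏ k, ((1 / (ε - Complex.I * c k)) ^ (1 / 2 : ℂ) *
        Complex.exp (-(inner ℝ (e k) F : ℝ) ^ 2 / (2 * (ε - Complex.I * c k)))))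
      (𝓝[>] 0) (𝓝 (∏ k, (Complex.exp (c k * (Real.pi / 4 * Complex.I)) *
        Complex.exp (-(Complex.I / 2) * (c k * (inner ℝ (e k) F : ℝ) ^ 2 : ℝ))))) := by
    refine tendsto_finsetProd _ fun k _ => ?_
    have hk : (c k : ℂ) ^ 2 = 1 := by rcases hc k with h | h <;> simp [h]
    have hz : (0 : ℂ) - Complex.I * c k ≠ 0 := by
      rcases hc k with h | h <;> simp [h]
    have hinv : 1 / ((0 : ℂ) - Complex.I * c k) = Complex.I * c k := by
      rw [div_eq_iff hz]
      linear_combination Complex.I ^ 2 * hk + Complex.I_sq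
    have h1 : Tendsto (fun ε : ℝ => (ε : ℂ) - Complex.I * c k) (𝓝[>] 0)
        (𝓝 (0 - Complex.I * c k)) := by
      refine tendsto_nhdsWithin_of_tendsto_nhds ?_
      have : Continuous fun ε : ℝ => (ε : ℂ) - Complex.I * c k := by fun_prop
      simpa using this.tendsto 0
    have h2 : Tendsto (fun ε : ℝ => 1 / ((ε : ℂ) - Complex.I * c k)) (𝓝[>] 0)
        (𝓝 (Complex.I * c k)) := by
      have := (tendsto_const_nhds (x := (1 : ℂ))).div h1 hz
      rwa [hinv] at this
    -- The limit `±i` avoids the branch cut, so the principal square root is continuous there.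
    have hslit : Complex.I * (c k : ℂ) ∈ Complex.slitPlane := by
      rcases hc k with h | h <;> simp [h, Complex.slitPlane]
    have hpow : (Complex.I * (c k : ℂ)) ^ (1 / 2 : ℂ) =
        Complex.exp (c k * (Real.pi / 4 * Complex.I)) := by
      rw [Complex.cpow_def_of_ne_zero (Complex.slitPlane_ne_zero hslit)]
      congr 1
      rcases hc k with h | h
      · rw [h, Complex.ofReal_one, mul_one, Complex.log_I]
        ring
      · rw [h, Complex.ofReal_neg, Complex.ofReal_one, mul_neg_one, Complex.log_neg_I]
        ring
    refine Tendsto.mul ?_ ?_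
    · rw [← hpow]
      exact h2.cpow tendsto_const_nhds hslit
    · refine (Complex.continuous_exp.tendsto _).comp ?_
      have h3 := h2.const_mul (-((inner ℝ (e k) F : ℝ) : ℂ) ^ 2 / 2)
      convert! h3 using 1
      · funext ε
        simp only [div_eq_mul_inv, mul_inv]
        ring
      · congr 1
        push_cast
        ring
  have hval : ∏ k, (Complex.exp (c k * (Real.pi / 4 * Complex.I)) *
        Complex.exp (-(Complex.I / 2) * (c k * (inner ℝ (e k) F : ℝ) ^ 2 : ℝ))) =
      Complex.exp (-(Complex.I / 2) * (inner ℝ F (S F) : ℝ)) := by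
    have hSF : inner ℝ F (S F) = ∑ k, c k * inner ℝ (e k) F ^ 2 := by
      have h1 : S F = ∑ k, (c k * inner ℝ (e k) F) • e k := by
        nth_rewrite 1 [← e.sum_repr' F]
        simp [he, smul_smul, mul_comm]
      rw [h1, inner_sum]
      refine Finset.sum_congr rfl fun k _ => ?_
      rw [real_inner_smul_right, real_inner_comm]
      ring
    -- The trace condition: the phases `exp (iπ c_k/4)` multiply to `1`.
    have hsum' : ∑ k, (c k : ℂ) = 0 := by exact_mod_cast hsum
    rw [Finset.prod_mul_distrib, ← Complex.exp_sum, ← Complex.exp_sum, ← Finset.sum_mul, hsum',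
      zero_mul, Complex.exp_zero, one_mul, ← Finset.mul_sum, hSF, ← Complex.ofReal_sum]
  rw [hval] at hlim
  refine hlim.congr' ?_
  filter_upwards [self_mem_nhdsWithin] with ε hε
  exact (integral_quadExp_mul_exp e he hε F).symm

/-- The distributions given by `exp (½ ((1 - ε) |x|² + i ⟨x, S x⟩))`, for a symmetric involution `S`
of trace zero, converge strongly as `ε` tends to zero, to a distribution with the `T`-transform
`exp (-i/2 ⟨F, S F⟩)`. -/
theorem exists_tendsto_quadExp (b : OrthonormalBasis ι ℝ E) {S : E →ₗ[ℝ] E} (hS : S.IsSymmetric)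
    (hS2 : ∀ x, S (S x) = x) (htr : LinearMap.trace ℝ E S = 0) :
    ∃ (Φreg : ℝ → Distribution b) (Φ : Distribution b),
      (∀ ε : ℝ, 0 < ε → IsGivenBy (Φreg ε) (quadExp S ε)) ∧
      Tendsto Φreg (𝓝[>] 0) (𝓝 Φ) ∧
      ∀ F, tTransform Φ F = Complex.exp (-(Complex.I / 2) * (inner ℝ F (S F) : ℝ)) := by
  classical
  -- The eigenbasis serves only to evaluate integrals; the chaos coefficients refer to the arbitrary
  -- basis `b`.
  set e := hS.eigenvectorBasis rfl
  set c := hS.eigenvalues rfl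
  have he (k) : S (e k) = c k • e k := hS.apply_eigenvectorBasis rfl k
  have hc2 (k) : c k * c k = 1 := by
    have h := hS2 (e k)
    rw [he, map_smul, he, smul_smul] at h
    have h1 := congrArg (fun v => inner ℝ (e k) v) h
    simpa [real_inner_smul_right] using h1
  have hc (k) : c k = 1 ∨ c k = -1 := mul_self_eq_one_iff.1 (hc2 k)
  have hsum : ∑ k, c k = 0 := by
    rw [← htr, hS.trace_eq_sum_eigenvalues rfl]
    rfl
  have hlimT := tendsto_integral_quadExp_mul_exp e he hc hsum
  set a : ℝ → (ι → ℕ) → ℂ := quadCoeff b S with ha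
  have ha0 (ε : ℝ) : a ε 0 = ∫ x, quadExp S ε x ∂(stdGaussian E) := by
    simp [ha, quadCoeff]
  have hrec {ε : ℝ} (hε : 0 < ε) := quadCoeff_add_single b hS hS2 hε
  set m : ℝ := 2 * Fintype.card ι + 1
  have hm : 0 ≤ m := by positivity
  have hbound {ε : ℝ} (hε : 0 < ε) : HasCoeffBound (a ε) 1 m := fun α => by
    refine (hasCoeffBound_of_recursion
      (norm_recursionMatrix_le (norm_cMatrix_le b hS hS2) hε) (hrec hε) α).trans ?_
    have : ‖a ε 0‖ ≤ 1 := by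
      rw [ha0]
      exact norm_integral_quadExp_le e he (fun k => by rcases hc k with h | h <;> simp [h]) hε
    gcongr
  have hlim (α : ι → ℕ) : ∃ y, Tendsto (fun ε => a ε α) (𝓝[>] 0) (𝓝 y) := by
    refine exists_tendsto_of_recursion (c := 1) (tendsto_recursionMatrix (cMatrix b S)) ?_ ?_ α
    · simp only [ha0]
      -- At `F = 0` the exponential is `1`, which gives the limit `1` of the initial values.
      simpa using hlimT 0
    · filter_upwards [self_mem_nhdsWithin] with ε hε
      exact hrec hε
  choose a₀ ha₀ using hlim
  have hbound₀ : HasCoeffBound a₀ 1 m := fun α =>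
    le_of_tendsto (ha₀ α).norm <| by
      filter_upwards [self_mem_nhdsWithin] with ε hε
      exact hbound hε α
  obtain ⟨q, hq⟩ := pow_unbounded_of_one_lt (m ^ 2) one_lt_two
  -- For `ε ≤ 0` no bound is available, so the limit coefficients are used as default values. The
  -- limit `ε ↓ 0` does not see them.
  set a' : ℝ → (ι → ℕ) → ℂ := fun ε => if 0 < ε then a ε else a₀ with ha'
  have hbound' (ε : ℝ) : HasCoeffBound (a' ε) 1 m := by
    simp only [ha']
    split_ifs with hε
    · exact hbound hε
    · exact hbound₀
  have hlim' (α : ι → ℕ) : Tendsto (fun ε => a' ε α) (𝓝[>] 0) (𝓝 (a₀ α)) := by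
    refine (ha₀ α).congr' ?_
    filter_upwards [self_mem_nhdsWithin] with ε hε
    simp only [ha', if_pos (Set.mem_Ioi.1 hε)]
  set Φreg : ℝ → Distribution b := fun ε => Distribution.ofCoeff b q (a' ε) ((hbound' ε).memℓp hq)
  set Φ : Distribution b := Distribution.ofCoeff b q a₀ (hbound₀.memℓp hq)
  have hgiven (ε : ℝ) (hε : 0 < ε) : IsGivenBy (Φreg ε) (quadExp S ε) :=
    Distribution.isGivenBy_ofCoeff b (hasGaussianBound_quadExp S hε)
      (continuous_quadExp S ε).aestronglyMeasurable q _ _ fun α => by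
        simp only [ha', if_pos hε]
        rfl
  have hΦ : Tendsto Φreg (𝓝[>] 0) (𝓝 Φ) := Distribution.tendsto_ofCoeff b hq hbound' hbound₀ hlim'
  refine ⟨Φreg, Φ, hgiven, hΦ, fun F => ?_⟩
  -- Evaluation at a test function is continuous, so the `T`-transform of `Φ` is the limit of the
  -- Gaussian integrals.
  have h1 : Tendsto (fun ε => Φreg ε (expTest b F)) (𝓝[>] 0) (𝓝 (Φ (expTest b F))) :=
    ((continuous_eval_const (expTest b F)).tendsto Φ).comp hΦ
  refine tendsto_nhds_unique h1 ((hlimT F).congr' ?_)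
  filter_upwards [self_mem_nhdsWithin] with ε hε
  rw [(hgiven ε hε (expTest b F)).2]
  refine integral_congr_ae ?_
  filter_upwards [(memLp_expI F).coeFn_toLp] with x hx
  change _ = quadExp S ε x * ((memLp_expI F).toLp _) x
  rw [hx]

end Transform

end Hida

/-! ### The swap on pairs of Hermitian matrices. -/

namespace HermMatPair

variable (N d : ℕ)

/-- The operator `(A, B) ↦ (B, A)` on the real space. -/
noncomputable def swap : HermMatPair N d →ₗ[ℝ] HermMatPair N d :=
  (WithLp.linearEquiv 2 ℝ _).symm.toLinearMap ∘ₗ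
    LinearMap.funLeft ℝ (HermMat N) Sum.swap ∘ₗ (WithLp.linearEquiv 2 ℝ _).toLinearMap

/-- The operator `(A, B) ↦ (A, -B)`. -/
noncomputable def reflect : HermMatPair N d →ₗ[ℝ] HermMatPair N d :=
  (WithLp.linearEquiv 2 ℝ _).symm.toLinearMap ∘ₗ
    LinearMap.pi (fun k => (Sum.elim (fun _ => 1) (fun _ => -1) k : ℝ) • LinearMap.proj k) ∘ₗ
      (WithLp.linearEquiv 2 ℝ _).toLinearMap

variable {N d}

@[simp]
theorem swap_apply (X : HermMatPair N d) (k : Fin d ⊕ Fin d) : swap N d X k = X k.swap := rfl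

@[simp]
theorem reflect_apply (X : HermMatPair N d) (k : Fin d ⊕ Fin d) :
    reflect N d X k = (Sum.elim (fun _ => 1) (fun _ => -1) k : ℝ) • X k := rfl

theorem swap_swap (X : HermMatPair N d) : swap N d (swap N d X) = X := by
  ext k : 1
  simp

theorem isSymmetric_swap : (swap N d).IsSymmetric := fun X Y => by
  simp only [PiLp.inner_apply, swap_apply, Fintype.sum_sum_type, Sum.swap_inl, Sum.swap_inr]
  rw [add_comm]

/-- Conjugation by the involution `(A, B) ↦ (A, -B)` turns the swap into its negative, so its trace
equals minus itself. -/
theorem trace_swap : LinearMap.trace ℝ (HermMatPair N d) (swap N d) = 0 := by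
  have h1 : reflect N d ∘ₗ reflect N d = LinearMap.id := by
    ext X k : 2
    rcases k with k | k <;> simp
  have h2 : reflect N d ∘ₗ swap N d ∘ₗ reflect N d = -swap N d := by
    ext X k : 2
    rcases k with k | k <;> simp
  have h3 := LinearMap.trace_comp_comm' (reflect N d) (swap N d ∘ₗ reflect N d)
  rw [h2, LinearMap.comp_assoc, h1, LinearMap.comp_id, map_neg] at h3
  linarith

theorem inner_toMatrix (A B : HermMat N) :
    ((inner ℝ A B : ℝ) : ℂ) = (A.toMatrix * B.toMatrix).trace := by
  have h : (starRingEnd ℂ) (A.toMatrix * B.toMatrix).trace = (A.toMatrix * B.toMatrix).trace := by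
    rw [starRingEnd_apply, ← Matrix.trace_conjTranspose, Matrix.conjTranspose_mul,
      HermMat.conjTranspose_toMatrix, HermMat.conjTranspose_toMatrix, Matrix.trace_mul_comm]
  rw [Matrix.trace_mul_comm] at h ⊢
  exact Complex.conj_eq_iff_re.1 h

theorem ofReal_inner (X Y : HermMatPair N d) :
    ((inner ℝ X Y : ℝ) : ℂ) = trPairing X.toMatPair Y.toMatPair := by
  rw [PiLp.inner_apply]
  push_cast
  exact Finset.sum_congr rfl fun k _ => inner_toMatrix _ _

theorem regFeynman_eq (ε : ℝ) (X : HermMatPair N d) :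
    regFeynman N d ε X =
      (2 ^ (d * N) * (Real.pi : ℂ) ^ (d * N ^ 2)) * Hida.quadExp (swap N d) ε X := by
  have h : trPairing X.toMatPair (regOp N d ε X.toMatPair) =
      -((1 - ε) * (inner ℝ X X : ℝ) + Complex.I * (inner ℝ X (swap N d X) : ℝ)) := by
    rw [ofReal_inner, ofReal_inner, trPairing, trPairing, trPairing, Finset.mul_sum, Finset.mul_sum,
      ← Finset.sum_add_distrib, ← Finset.sum_neg_distrib]
    refine Finset.sum_congr rfl fun k _ => ?_
    have hk : regOp N d ε X.toMatPair k =
        -((1 - (ε : ℂ)) • X.toMatPair k + Complex.I • (swap N d X).toMatPair k) := rfl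
    rw [hk, mul_neg, Matrix.trace_neg, mul_add, Matrix.trace_add, Matrix.mul_smul, Matrix.mul_smul,
      Matrix.trace_smul, Matrix.trace_smul, smul_eq_mul, smul_eq_mul]
  rw [regFeynman, h, Hida.quadExp, real_inner_self_eq_norm_sq]
  congr 2
  push_cast
  ring

theorem inner_mk_swap (F G : Fin d → HermMat N) :
    ((inner ℝ (mk F G) (swap N d (mk F G)) : ℝ) : ℂ) =
      2 * ∑ μ, ((F μ).toMatrix * (G μ).toMatrix).trace := by
  rw [ofReal_inner, trPairing, Fintype.sum_sum_type]
  change ∑ μ, ((F μ).toMatrix * (G μ).toMatrix).trace +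
    ∑ μ, ((G μ).toMatrix * (F μ).toMatrix).trace = _
  simp only [fun μ => Matrix.trace_mul_comm (G μ).toMatrix (F μ).toMatrix]
  ring

end HermMatPair

/-- `Hida.IsGivenBy` prescribes every value of `Φreg ε` for `ε > 0`, so the existential leaves no
freedom there. The constant is a scalar multiple throughout, and the factor `2` in
`HermMatPair.inner_mk_swap` cancels the `½` of the `T`-transform. -/
theorem proposition3p4 {ι : Type*} [Fintype ι] (N d : ℕ)
    (b : OrthonormalBasis ι ℝ (HermMatPair N d)) :
    ∃ (Φreg : ℝ → Hida.Distribution b) (Φ : Hida.Distribution b),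
      (∀ ε : ℝ, 0 < ε → Hida.IsGivenBy (Φreg ε) (regFeynman N d ε)) ∧
      Tendsto Φreg (𝓝[>] 0) (𝓝 Φ) ∧
      ∀ F G : Fin d → HermMat N,
        Hida.tTransform Φ (HermMatPair.mk F G) =
          2 ^ (d * N) * (Real.pi : ℂ) ^ (d * N ^ 2) *
            Complex.exp (-Complex.I * ∑ μ, ((F μ).toMatrix * (G μ).toMatrix).trace) := by
  obtain ⟨Φreg, Φ, h1, h2, h3⟩ := Hida.exists_tendsto_quadExp b
    HermMatPair.isSymmetric_swap HermMatPair.swap_swap HermMatPair.trace_swap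
  set c : ℂ := 2 ^ (d * N) * (Real.pi : ℂ) ^ (d * N ^ 2) with hc
  refine ⟨fun ε => c • Φreg ε, c • Φ, fun ε hε φ => ?_, h2.const_smul c, fun F G => ?_⟩
  · have hφ := h1 ε hε φ
    simp only [HermMatPair.regFeynman_eq, ← hc, mul_assoc c]
    refine ⟨hφ.1.const_mul c, ?_⟩
    rw [integral_const_mul, ← hφ.2]
    rfl
  · have hF := h3 (HermMatPair.mk F G)
    rw [HermMatPair.inner_mk_swap] at hF
    change c * Hida.tTransform Φ (HermMatPair.mk F G) = _
    rw [hF]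
    congr 2
    ring
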